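/- Let $1\le p<\infty$, $p\ne 2$, and let $H^p$ be the Hardy space of the open unit disc $D$, i.e. the analytic $f:D\to\mathbb C$ with $\|f\|_p=\sup_{0<r<1}\bigl(\int_{T}|f(r\zeta)|^p\,dm(\zeta)\bigr)^{1/p}<\infty$, where $m$ is normalized Lebesgue measure on the unit circle $T$. Let $\mathbb A$ be the set of automorphisms $\phi(z)=\lambda\frac{z-a}{1-\bar a z}$ of $D$ ($|\lambda|=1$, $a\in D$); for such $\phi$ put $U_\phi f=(\bar\lambda\phi')^{1/p}\,(f\circ\phi)$ (principal branch of the power), and for $\psi\in\mathbb A$ let $M_\psi$ be multiplication by $\psi$. An automorphism is elliptic if it is not the identity and has a fixed point in $D$. A bounded linear operator $S$ on $H^p$ is Crownover if it is an isometry whose range has codimension one and $\bigcap_{n=1}^\infty S^nH^p=\{0\}$. If $\phi\in\mathbb A$ is elliptic and $\psi\in\mathbb A$, then $M_\psi U_\phi$ is a bounded operator on $H^p$ and is Crownover. Moreover, writing $\phi_n$ for the $n$-fold composition of $\phi$ with itself ($\phi_0(z)=z$), each $\psi\circ\phi_n$, $n\ge 0$, has exactly one zero $a_n$ in $D$; there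 is a circle that is contained, together with its interior, in $D$ and contains all the $a_n$; and $\sum_{n\ge0}(1-|a_n|)=\infty$, i.e. $(a_n)$ is not a Blaschke sequence. -/

import Mathlib

open Metric Set Function
open scoped Complex.UnitDisc ComplexConjugate Real

noncomputable section

/-! ### Automorphisms of the unit disc -/

/-- A holomorphic automorphism of the unit disc, `z ↦ lam * (z - a) / (1 - conj a * z)` with
`|lam| = 1` and `|a| < 1`. The parameters `lam` and `a` are determined by the map. -/
structure DiscAut where
  /-- the unimodular factor -/
  lam : ℂ
  /-- the zero of the automorphism -/
  a : ℂ
  norm_lam : ‖lam‖ = 1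
  norm_a : ‖a‖ < 1

namespace DiscAut

/-- The defining formula of the automorphism, as a function of a complex variable. -/
def formula (φ : DiscAut) (z : ℂ) : ℂ :=
  φ.lam * (z - φ.a) / (1 - conj φ.a * z)

theorem norm_formula_lt_one (φ : DiscAut) {z : ℂ} (hz : ‖z‖ < 1) : ‖φ.formula z‖ < 1 := by
  have ha := φ.norm_a
  have hne : 1 - conj φ.a * z ≠ 0 := by
    intro h
    have h1 : conj φ.a * z = 1 := (sub_eq_zero.mp h).symm
    have h2 : ‖φ.a‖ * ‖z‖ = 1 := by
      have := congrArg norm h1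
      simpa using this
    nlinarith [norm_nonneg φ.a, norm_nonneg z]
  have hpos : 0 < ‖1 - conj φ.a * z‖ := norm_pos_iff.mpr hne
  unfold formula
  rw [norm_div, norm_mul, φ.norm_lam, one_mul, div_lt_one hpos]
  have key : ‖1 - conj φ.a * z‖ ^ 2 - ‖z - φ.a‖ ^ 2 = (1 - ‖φ.a‖ ^ 2) * (1 - ‖z‖ ^ 2) := by
    simp only [← Complex.normSq_eq_norm_sq, Complex.normSq_apply, Complex.sub_re, Complex.sub_im,
      Complex.mul_re, Complex.mul_im, Complex.conj_re, Complex.conj_im, Complex.one_re,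
      Complex.one_im]
    ring
  have h1 : 0 < (1 - ‖φ.a‖ ^ 2) * (1 - ‖z‖ ^ 2) := by
    apply mul_pos
    · nlinarith [norm_nonneg φ.a]
    · nlinarith [norm_nonneg z]
  exact lt_of_pow_lt_pow_left₀ 2 hpos.le (by linarith)

/-- The automorphism as a self-map of the unit disc. -/
def toFun (φ : DiscAut) (z : 𝔻) : 𝔻 :=
  Complex.UnitDisc.mk (φ.formula z) (φ.norm_formula_lt_one z.norm_lt_one)

instance : CoeFun DiscAut (fun _ => 𝔻 → 𝔻) := ⟨toFun⟩

/-- `φ` is elliptic: it is not the identity and it has a fixed point in the open disc. -/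
def IsElliptic (φ : DiscAut) : Prop :=
  (φ : 𝔻 → 𝔻) ≠ id ∧ ∃ a : 𝔻, φ a = a

end DiscAut

/-! ### Hardy spaces -/

/-- Extension by zero of a function on the disc to the plane. -/
def discExtend (f : 𝔻 → ℂ) : ℂ → ℂ :=
  Function.extend ((↑) : 𝔻 → ℂ) f 0

/-- `f` is holomorphic on the disc. -/
def IsDiscHolomorphic (f : 𝔻 → ℂ) : Prop :=
  DifferentiableOn ℂ (discExtend f) (ball 0 1)

/-- The integral mean `(∫_T |f(r ζ)|^p dm(ζ))^(1/p)`, where `m` is normalized Lebesgue measure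
on the unit circle `T`. -/
def hardyMean (p : ℝ) (f : 𝔻 → ℂ) (r : ℝ) : ℝ :=
  (Real.circleAverage (fun z => ‖discExtend f z‖ ^ p) 0 r) ^ (1 / p)

theorem discExtend_coe (f : 𝔻 → ℂ) (z : 𝔻) : discExtend f z = f z :=
  Complex.UnitDisc.coe_injective.extend_apply f 0 z

theorem discExtend_add (f g : 𝔻 → ℂ) : discExtend (f + g) = discExtend f + discExtend g := by
  have := Function.extend_add ((↑) : 𝔻 → ℂ) f g 0 0
  simpa [discExtend] using this

theorem discExtend_smul (c : ℂ) (f : 𝔻 → ℂ) : discExtend (c • f) = c • discExtend f := by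
  have := Function.extend_smul c ((↑) : 𝔻 → ℂ) f 0
  simpa [discExtend] using this

theorem discExtend_zero : discExtend 0 = 0 := by
  simpa using discExtend_smul 0 0

theorem IsDiscHolomorphic.continuous_circle {f : 𝔻 → ℂ} (hf : IsDiscHolomorphic f) {r : ℝ}
    (hr : r ∈ Ioo (0 : ℝ) 1) : Continuous (fun θ : ℝ => discExtend f (circleMap 0 r θ)) := by
  refine ContinuousOn.comp_continuous hf.continuousOn (continuous_circleMap 0 r) ?_
  intro θ
  simp [abs_of_pos hr.1, hr.2]

theorem hardyMean_nonneg (p : ℝ) (f : 𝔻 → ℂ) (r : ℝ) : 0 ≤ hardyMean p f r := by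
  apply Real.rpow_nonneg
  exact Real.circleAverage_nonneg_of_nonneg fun x _ => by positivity

theorem IsDiscHolomorphic.memLp_circle {f : 𝔻 → ℂ} (hf : IsDiscHolomorphic f) (p : ℝ) {r : ℝ}
    (hr : r ∈ Ioo (0 : ℝ) 1) :
    MeasureTheory.MemLp (fun θ : ℝ => discExtend f (circleMap 0 r θ)) (ENNReal.ofReal p)
      (MeasureTheory.volume.restrict (Ioc 0 (2 * π))) := by
  have hc := hf.continuous_circle hr
  obtain ⟨C, hC⟩ := isCompact_Icc.exists_bound_of_continuousOn (s := Icc 0 (2 * π)) hc.continuousOn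
  refine MeasureTheory.MemLp.of_bound hc.aestronglyMeasurable C ?_
  refine (MeasureTheory.ae_restrict_iff' measurableSet_Ioc).mpr (Filter.Eventually.of_forall ?_)
  exact fun θ hθ => hC θ (Ioc_subset_Icc_self hθ)

theorem hardyMean_eq_eLpNorm {p : ℝ} (hp : 1 ≤ p) {f : 𝔻 → ℂ} (hf : IsDiscHolomorphic f) {r : ℝ}
    (hr : r ∈ Ioo (0 : ℝ) 1) :
    hardyMean p f r = ((2 * π)⁻¹) ^ (1 / p) *
      (MeasureTheory.eLpNorm (fun θ : ℝ => discExtend f (circleMap 0 r θ)) (ENNReal.ofReal p)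
        (MeasureTheory.volume.restrict (Ioc 0 (2 * π)))).toReal := by
  have hp0 : 0 < p := by linarith
  have h0 : ENNReal.ofReal p ≠ 0 := by simpa using hp0
  rw [(hf.memLp_circle p hr).eLpNorm_eq_integral_rpow_norm h0 ENNReal.ofReal_ne_top,
    ENNReal.toReal_ofReal hp0.le, ENNReal.toReal_ofReal (by positivity), hardyMean, Real.circleAverage,
    intervalIntegral.integral_of_le (by positivity), smul_eq_mul,
    Real.mul_rpow (by positivity) (by positivity), one_div]

theorem hardyMean_add_le {p : ℝ} (hp : 1 ≤ p) {f g : 𝔻 → ℂ} (hf : IsDiscHolomorphic f)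
    (hg : IsDiscHolomorphic g) {r : ℝ} (hr : r ∈ Ioo (0 : ℝ) 1) :
    hardyMean p (f + g) r ≤ hardyMean p f r + hardyMean p g r := by
  have hfg : IsDiscHolomorphic (f + g) := by
    unfold IsDiscHolomorphic
    rw [discExtend_add]
    exact DifferentiableOn.add hf hg
  rw [hardyMean_eq_eLpNorm hp hf hr, hardyMean_eq_eLpNorm hp hg hr, hardyMean_eq_eLpNorm hp hfg hr,
    ← mul_add]
  have h1 := hf.memLp_circle p hr
  have h2 := hg.memLp_circle p hr
  gcongr
  rw [← ENNReal.toReal_add h1.2.ne h2.2.ne]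
  refine ENNReal.toReal_mono (ENNReal.add_ne_top.mpr ⟨h1.2.ne, h2.2.ne⟩) ?_
  have := MeasureTheory.eLpNorm_add_le h1.1 h2.1 (p := ENNReal.ofReal p) (by simpa using hp)
  rw [discExtend_add]
  exact this

theorem hardyMean_smul {p : ℝ} (hp : 1 ≤ p) (c : ℂ) (f : 𝔻 → ℂ) (r : ℝ) :
    hardyMean p (c • f) r = ‖c‖ * hardyMean p f r := by
  have hp0 : p ≠ 0 := by linarith
  have h : (fun z => ‖discExtend (c • f) z‖ ^ p) =
      fun z => ‖c‖ ^ p • ‖discExtend f z‖ ^ p := by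
    funext z
    rw [discExtend_smul, Pi.smul_apply, norm_smul, Real.mul_rpow (norm_nonneg _) (norm_nonneg _),
      smul_eq_mul]
  rw [hardyMean, h, Real.circleAverage_fun_smul, smul_eq_mul, Real.mul_rpow (by positivity)
    (Real.circleAverage_nonneg_of_nonneg fun x _ => by positivity), one_div,
    Real.rpow_rpow_inv (norm_nonneg _) hp0, hardyMean, one_div]

theorem hardyMean_zero {p : ℝ} (hp : 1 ≤ p) (r : ℝ) : hardyMean p 0 r = 0 := by
  simpa using hardyMean_smul hp 0 0 r

theorem eq_zero_of_hardyMean {p : ℝ} (hp : 1 ≤ p) {f : 𝔻 → ℂ} (hf : IsDiscHolomorphic f)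
    (h : ∀ r ∈ Ioo (0 : ℝ) 1, hardyMean p f r = 0) : f = 0 := by
  have hp0 : 0 < p := by linarith
  have hne : ∀ z : 𝔻, (z : ℂ) ≠ 0 → f z = 0 := by
    intro z hz
    by_contra hfz
    have hr : ‖(z : ℂ)‖ ∈ Ioo (0 : ℝ) 1 := ⟨norm_pos_iff.mpr hz, z.norm_lt_one⟩
    have hm : (z : ℂ) ∈ sphere (0 : ℂ) |‖(z : ℂ)‖| := by simp
    rw [← image_circleMap_Ioc] at hm
    obtain ⟨θ, hθ, hzθ⟩ := hm
    have hc := hf.continuous_circle hr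
    have hpos : 0 < ∫ θ in (0 : ℝ)..2 * π, ‖discExtend f (circleMap 0 ‖(z : ℂ)‖ θ)‖ ^ p := by
      refine intervalIntegral.integral_pos (by positivity) ?_ ?_ ?_
      · exact (hc.norm.rpow_const fun _ => Or.inr hp0.le).continuousOn
      · intro x _
        positivity
      · refine ⟨θ, Ioc_subset_Icc_self hθ, ?_⟩
        rw [hzθ, discExtend_coe]
        exact Real.rpow_pos_of_pos (norm_pos_iff.mpr hfz) p
    have h1 := h _ hr
    have h2 : 0 < hardyMean p f ‖(z : ℂ)‖ := by
      refine Real.rpow_pos_of_pos ?_ _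
      rw [Real.circleAverage, smul_eq_mul]
      exact mul_pos (by positivity) hpos
    linarith
  have hEq : EqOn (discExtend f) 0 (ball 0 1 \ {0}) := by
    rintro z ⟨hz, hz0⟩
    have := hne (Complex.UnitDisc.mk z (by simpa using hz)) (by simpa using hz0)
    rw [← discExtend_coe f] at this
    simpa using this
  funext z
  by_cases hz : (z : ℂ) = 0
  · have h0 : (0 : ℂ) ∈ ball (0 : ℂ) 1 := by simp
    have hcont : ContinuousAt (discExtend f) 0 :=
      (hf.continuousOn 0 h0).continuousAt (isOpen_ball.mem_nhds h0)
    have ht : Filter.Tendsto (discExtend f) (nhdsWithin 0 {0}ᶜ) (nhds (discExtend f 0)) :=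
      hcont.tendsto.mono_left nhdsWithin_le_nhds
    have ht0 : Filter.Tendsto (discExtend f) (nhdsWithin 0 {0}ᶜ) (nhds 0) := by
      refine tendsto_const_nhds.congr' ?_
      filter_upwards [self_mem_nhdsWithin, nhdsWithin_le_nhds (isOpen_ball.mem_nhds h0)]
        with w hw hw1
      exact (hEq ⟨hw1, hw⟩).symm
    have := tendsto_nhds_unique ht ht0
    rw [← discExtend_coe f, hz, this]
    rfl
  · exact hne z hz

/-- The Hardy space `H^p` as a space of functions on the disc: the holomorphic functions whose
`p`-th integral means over the circles of radius `0 < r < 1` are bounded. -/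
def hardySubmodule (p : ℝ) [Fact (1 ≤ p)] : Submodule ℂ (𝔻 → ℂ) where
  carrier := {f | IsDiscHolomorphic f ∧ BddAbove (hardyMean p f '' Ioo 0 1)}
  add_mem' := by
    rintro f g ⟨hf, C, hC⟩ ⟨hg, D, hD⟩
    refine ⟨?_, C + D, ?_⟩
    · unfold IsDiscHolomorphic
      rw [discExtend_add]
      exact DifferentiableOn.add hf hg
    · rintro _ ⟨r, hr, rfl⟩
      exact (hardyMean_add_le Fact.out hf hg hr).trans
        (add_le_add (hC (mem_image_of_mem _ hr)) (hD (mem_image_of_mem _ hr)))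
  zero_mem' := by
    refine ⟨?_, 0, ?_⟩
    · unfold IsDiscHolomorphic
      rw [discExtend_zero]
      exact differentiableOn_const 0
    · rintro _ ⟨r, hr, rfl⟩
      exact (hardyMean_zero Fact.out r).le
  smul_mem' := by
    rintro c f ⟨hf, C, hC⟩
    refine ⟨?_, ‖c‖ * C, ?_⟩
    · unfold IsDiscHolomorphic
      rw [discExtend_smul]
      exact DifferentiableOn.const_smul hf c
    · rintro _ ⟨r, hr, rfl⟩
      rw [hardyMean_smul Fact.out]
      exact mul_le_mul_of_nonneg_left (hC (mem_image_of_mem _ hr)) (norm_nonneg c)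

/-- The Hardy space `H^p` of the unit disc. -/
def HardySpace (p : ℝ) [Fact (1 ≤ p)] : Type := hardySubmodule p

namespace HardySpace

variable {p : ℝ} [Fact (1 ≤ p)]

instance : AddCommGroup (HardySpace p) := inferInstanceAs (AddCommGroup (hardySubmodule p))

instance : Module ℂ (HardySpace p) := inferInstanceAs (Module ℂ (hardySubmodule p))

/-- The inclusion of `H^p` into the space of all functions on the disc. -/
def toFun : HardySpace p →ₗ[ℂ] (𝔻 → ℂ) := (hardySubmodule p).subtype

instance : CoeFun (HardySpace p) (fun _ => 𝔻 → ℂ) := ⟨fun f => toFun f⟩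

/-- The norm of `H^p`: the supremum over `0 < r < 1` of the `p`-th integral means. -/
instance : Norm (HardySpace p) := ⟨fun f => sSup (hardyMean p f '' Ioo 0 1)⟩

theorem norm_def (f : HardySpace p) : ‖f‖ = sSup (hardyMean p f '' Ioo 0 1) := rfl

theorem hardyMean_le_norm (f : HardySpace p) {r : ℝ} (hr : r ∈ Ioo (0 : ℝ) 1) :
    hardyMean p f r ≤ ‖f‖ :=
  le_csSup f.2.2 (mem_image_of_mem _ hr)

theorem norm_le_of_forall (f : HardySpace p) {C : ℝ}
    (h : ∀ r ∈ Ioo (0 : ℝ) 1, hardyMean p f r ≤ C) : ‖f‖ ≤ C := by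
  refine csSup_le ((nonempty_Ioo.mpr one_pos).image _) ?_
  rintro _ ⟨r, hr, rfl⟩
  exact h r hr

theorem normCore : NormedSpace.Core ℂ (HardySpace p) where
  norm_nonneg f := by
    refine Real.sSup_nonneg ?_
    rintro _ ⟨r, hr, rfl⟩
    exact hardyMean_nonneg p _ r
  norm_smul c f := by
    rw [norm_def, norm_def, ← smul_eq_mul, ← Real.sSup_smul_of_nonneg (norm_nonneg c)]
    congr 1
    ext x
    simp [mem_smul_set, hardyMean_smul (p := p) Fact.out]
  norm_triangle f g := by
    refine norm_le_of_forall _ fun r hr => ?_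
    rw [map_add]
    exact (hardyMean_add_le Fact.out f.2.1 g.2.1 hr).trans
      (add_le_add (hardyMean_le_norm f hr) (hardyMean_le_norm g hr))
  norm_eq_zero_iff f := by
    constructor
    · intro h
      have : (f : 𝔻 → ℂ) = 0 := by
        refine eq_zero_of_hardyMean (p := p) Fact.out f.2.1 fun r hr => ?_
        exact le_antisymm ((hardyMean_le_norm f hr).trans h.le) (hardyMean_nonneg p _ r)
      exact Subtype.ext this
    · rintro rfl
      refine le_antisymm (norm_le_of_forall _ fun r hr => ?_) ?_
      · rw [map_zero, hardyMean_zero Fact.out]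
      · refine Real.sSup_nonneg ?_
        rintro _ ⟨r, hr, rfl⟩
        exact hardyMean_nonneg p _ r

instance : NormedAddCommGroup (HardySpace p) := NormedAddCommGroup.ofCore normCore

instance : NormedSpace ℂ (HardySpace p) := NormedSpace.ofCore normCore

end HardySpace

/-! ### Operators -/

/-- Multiplication `M_F` by a function `F` on the disc. -/
def mulOp (F : 𝔻 → ℂ) : (𝔻 → ℂ) →ₗ[ℂ] (𝔻 → ℂ) := LinearMap.mulLeft ℂ F

/-- Composition `C_φ f = f ∘ φ` with an automorphism `φ`. -/
def compOp (φ : DiscAut) : (𝔻 → ℂ) →ₗ[ℂ] (𝔻 → ℂ) := LinearMap.funLeft ℂ ℂ φ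

/-- The operator `U_φ f = (conj lam * φ')^(1/p) * (f ∘ φ)`, with the principal branch of the
power. -/
def forelliOp (p : ℝ) (φ : DiscAut) : (𝔻 → ℂ) →ₗ[ℂ] (𝔻 → ℂ) :=
  mulOp (fun z => (conj φ.lam * deriv φ.formula z) ^ ((1 / p : ℝ) : ℂ)) ∘ₗ compOp φ

/-- A bounded operator `S` on a normed space is Crownover if it is an isometry, its range has
codimension one, and the ranges of its powers `S^n`, `n ≥ 1`, have trivial intersection. -/
structure IsCrownover {X : Type*} [NormedAddCommGroup X] [NormedSpace ℂ X] (S : X →L[ℂ] X) :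
    Prop where
  isometry : Isometry S
  codim_one : Module.finrank ℂ (X ⧸ LinearMap.range (S : X →ₗ[ℂ] X)) = 1
  iInter_range : ⋂ (n : ℕ) (_ : 1 ≤ n), range (S ^ n : X →L[ℂ] X) = {0}

end

noncomputable section

open MeasureTheory Filter Topology

/-! ### Poisson integrals and monotonicity of integral means -/

/-! On the unit circle `|ψ| = 1`, and `|φ'| dm` is the pullback of `dm` under `φ`, so `M_ψ U_φ`
formally preserves the `L^p` norm of boundary values. Boundary values are avoided here: for each
constant `C`, the means of `M_ψ U_φ f` over all radii `r < 1` are at most `C` iff those of `f` are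
(`circleAverage_mulForelli_le_iff`). The tools are monotonicity of the means in the radius (Poisson
integrals and convexity of `t^p`), the change of variables on the circle, dilations `F(Rz)` with `R
→ 1`, and `|ψ| → 1` uniformly at the boundary.

A function in `H^p` can be divided by `ψ` within `H^p` exactly when it vanishes at the zero of `ψ`,
and `U_φ` is invertible. The range is thus the kernel of a point evaluation and has codimension one.

For the intersection of the ranges, Schwarz–Pick gives, with `S = M_ψ U_φ`, `(1-|z|²)^(1/p) |Sf(z)|
= |ψ(z)| (1-|φ(z)|²)^(1/p) |f(φ(z))|`. If `φ` fixes `q`, orbits keep a constant pseudo-hyperbolic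
distance to `q`, so they stay in a compact set on which `|ψ| ≤ δ < 1`. If `f = S^n g`, then `‖g‖ =
‖f‖`, and iteration bounds `|f(z)|` by a constant times `δ^n ‖f‖` for every `n`.

The same invariance puts the zeros `a_n = φ⁻ⁿ(ψ⁻¹(0))` on a pseudo-hyperbolic circle about `q`,
which is a Euclidean circle inside the disc. If it degenerates to the point `q`, any small circle
through `q` serves. -/

theorem poissonKernel_nonneg_of_mem {R : ℝ} {w z : ℂ} (hw : ‖w‖ < R) (hz : ‖z‖ = R) :
    0 ≤ poissonKernel 0 w z := by
  rw [poissonKernel_def]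
  simp only [sub_zero]
  apply div_nonneg _ (by positivity)
  rw [hz]
  nlinarith [norm_nonneg w]

theorem continuousOn_poissonKernel_sphere {R : ℝ} {w : ℂ} (hw : ‖w‖ < R) :
    ContinuousOn (poissonKernel 0 w) (sphere 0 R) := by
  have h : poissonKernel 0 w = fun z => (‖z‖ ^ 2 - ‖w‖ ^ 2) / ‖z - w‖ ^ 2 := by
    funext z
    simp [poissonKernel_def]
  rw [h]
  refine ContinuousOn.div (by fun_prop) (by fun_prop) ?_
  intro z hz
  have hz : ‖z‖ = R := by simpa using hz
  have : z - w ≠ 0 := by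
    rintro h
    rw [sub_eq_zero] at h
    rw [h] at hz
    linarith
  positivity

theorem circleAverage_poissonKernel {R : ℝ} {w : ℂ} (hw : ‖w‖ < R) :
    Real.circleAverage (poissonKernel 0 w) 0 R = 1 := by
  have h := DiffContOnCl.circleAverage_poissonKernel_smul (f := fun _ : ℂ => (1 : ℂ)) (c := 0)
    (R := R) (w := w) diffContOnCl_const (by simpa using hw)
  have hR : 0 < R := (norm_nonneg w).trans_lt hw
  have hint : CircleIntegrable (poissonKernel 0 w) 0 R :=
    (continuousOn_poissonKernel_sphere hw).circleIntegrable hR.le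
  have h2 := Complex.ofRealCLM.circleAverage_comp_comm hint
  have h3 : (Complex.ofRealCLM ∘ poissonKernel 0 w : ℂ → ℂ)
      = poissonKernel 0 w • fun _ : ℂ => (1 : ℂ) := by
    funext z
    simp
  rw [h3, h] at h2
  exact Complex.ofReal_injective (by simpa using h2.symm)

/-- Bernoulli's inequality at `t / s`, scaled by `s ^ p`: the convex function `t ^ p` lies above its
tangent at `s`. -/
theorem rpow_tangent_le {p s t : ℝ} (hp : 1 ≤ p) (hs : 0 < s) (ht : 0 ≤ t) :
    s ^ p + p * s ^ (p - 1) * (t - s) ≤ t ^ p := by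
  have h1 := one_add_mul_self_le_rpow_one_add (s := t / s - 1) (by
    have : 0 ≤ t / s := by positivity
    linarith) hp
  have h2 : t ^ p = s ^ p * (t / s) ^ p := by
    rw [← Real.mul_rpow hs.le (by positivity), mul_div_cancel₀ _ hs.ne']
  have h3 : s ^ p = s ^ (p - 1) * s := by
    rw [← Real.rpow_add_one hs.ne']
    ring_nf
  rw [h2]
  calc s ^ p + p * s ^ (p - 1) * (t - s) = s ^ p * (1 + p * (t / s - 1)) := by
        rw [h3]
        field_simp
    _ ≤ s ^ p * (t / s) ^ p := by
        gcongr
        simpa using h1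

theorem continuousOn_sphere_of_diffContOnCl {R : ℝ} (hR : 0 < R) {h : ℂ → ℂ}
    (hh : DiffContOnCl ℂ h (ball 0 R)) : ContinuousOn h (sphere 0 R) :=
  hh.continuousOn.mono (by rw [closure_ball _ hR.ne']; exact sphere_subset_closedBall)

/-- The `p`-th power of the modulus of a holomorphic function is bounded by its Poisson
integral. -/
theorem norm_rpow_le_circleAverage_poissonKernel {p : ℝ} (hp : 1 ≤ p) {R : ℝ} {h : ℂ → ℂ}
    (hh : DiffContOnCl ℂ h (ball 0 R)) {w : ℂ} (hw : ‖w‖ < R) :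
    ‖h w‖ ^ p ≤ Real.circleAverage (fun z => poissonKernel 0 w z * ‖h z‖ ^ p) 0 R := by
  have hp0 : 0 < p := by linarith
  have hR : 0 < R := (norm_nonneg w).trans_lt hw
  have hcP := continuousOn_poissonKernel_sphere hw
  have hch := continuousOn_sphere_of_diffContOnCl hR hh
  have hnn : ∀ z ∈ sphere (0 : ℂ) |R|, 0 ≤ poissonKernel 0 w z := fun z hz =>
    poissonKernel_nonneg_of_mem hw (by simpa [abs_of_pos hR] using hz)
  rcases (norm_nonneg (h w)).eq_or_lt with h0 | hpos
  · rw [← h0, Real.zero_rpow hp0.ne']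
    have : Real.circleAverage (fun _ => (0 : ℝ)) (0 : ℂ) R ≤
        Real.circleAverage (fun z => poissonKernel 0 w z * ‖h z‖ ^ p) 0 R := by
      refine Real.circleAverage_mono (circleIntegrable_const _ _ _) ?_ ?_
      · exact (hcP.mul (hch.norm.rpow_const fun _ _ => Or.inr hp0.le)).circleIntegrable hR.le
      · intro z hz
        have := hnn z hz
        positivity
    rwa [Real.circleAverage_const] at this
  set s := ‖h w‖ with hs
  have hcI : CircleIntegrable (fun z => poissonKernel 0 w z * ‖h z‖) 0 R :=
    (hcP.mul hch.norm).circleIntegrable hR.le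
  have hPI : CircleIntegrable (poissonKernel 0 w) 0 R := hcP.circleIntegrable hR.le
  have h1 : s ≤ Real.circleAverage (fun z => poissonKernel 0 w z * ‖h z‖) 0 R := by
    rw [hs, ← DiffContOnCl.circleAverage_poissonKernel_smul hh (by simpa using hw : w ∈ ball 0 R)]
    rw [Real.circleAverage, Real.circleAverage, norm_smul, smul_eq_mul,
      Real.norm_of_nonneg (by positivity)]
    gcongr
    refine (intervalIntegral.norm_integral_le_integral_norm (by positivity)).trans (le_of_eq ?_)
    refine intervalIntegral.integral_congr fun θ _ => ?_
    simp only [Pi.smul_apply', norm_smul]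
    rw [Real.norm_of_nonneg (hnn _ (circleMap_mem_sphere' 0 R θ))]
  -- Jensen's inequality by hand: the tangent line of `t ^ p` at `s` is averaged against the Poisson
  -- kernel, which has mass one. As the slope `k` is nonnegative, `h1` finishes the estimate.
  set k := p * s ^ (p - 1) with hk
  have hk0 : 0 ≤ k := by positivity
  have h2 : Real.circleAverage (fun z => (s ^ p - k * s) • poissonKernel 0 w z +
      k • (poissonKernel 0 w z * ‖h z‖)) 0 R
      = (s ^ p - k * s) + k * Real.circleAverage (fun z => poissonKernel 0 w z * ‖h z‖) 0 R := by
    rw [Real.circleAverage_fun_add, Real.circleAverage_fun_smul, Real.circleAverage_fun_smul]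
    · have := circleAverage_poissonKernel hw
      change Real.circleAverage (fun z => poissonKernel 0 w z) 0 R = 1 at this
      rw [this]
      simp
    · exact hPI.const_smul (a := s ^ p - k * s)
    · exact hcI.const_smul (a := k)
  have h3 : Real.circleAverage (fun z => (s ^ p - k * s) • poissonKernel 0 w z +
      k • (poissonKernel 0 w z * ‖h z‖)) 0 R ≤
      Real.circleAverage (fun z => poissonKernel 0 w z * ‖h z‖ ^ p) 0 R := by
    refine Real.circleAverage_mono ?_ ?_ ?_
    · exact (hPI.const_smul (a := s ^ p - k * s)).add (hcI.const_smul (a := k))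
    · exact (hcP.mul (hch.norm.rpow_const fun _ _ => Or.inr hp0.le)).circleIntegrable hR.le
    · intro z hz
      have := mul_le_mul_of_nonneg_left (rpow_tangent_le hp hpos (norm_nonneg (h z))) (hnn z hz)
      refine le_trans (le_of_eq ?_) this
      simp only [smul_eq_mul, hk]
      ring
  nlinarith

/-- The distance between the two points depends only on `cos (s - t)`, which is even. This lets the
kernel be integrated in its other variable. -/
theorem poissonKernel_circleMap_swap {r R s t : ℝ} :
    poissonKernel 0 (circleMap 0 r s) (circleMap 0 R t) =
      poissonKernel 0 (circleMap 0 r t) (circleMap 0 R s) := by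
  simp only [poissonKernel_def, sub_zero]
  congr 1
  · simp
  · have : ∀ a b : ℝ, ‖circleMap 0 R a - circleMap 0 r b‖ ^ 2 =
        R ^ 2 + r ^ 2 - 2 * R * r * Real.cos (a - b) := by
      intro a b
      rw [← Complex.normSq_eq_norm_sq, Complex.normSq_apply, Real.cos_sub]
      simp only [circleMap, zero_add, Complex.sub_re, Complex.sub_im, Complex.re_ofReal_mul,
        Complex.im_ofReal_mul, Complex.exp_ofReal_mul_I_re, Complex.exp_ofReal_mul_I_im]
      linear_combination R ^ 2 * Real.sin_sq_add_cos_sq a + r ^ 2 * Real.sin_sq_add_cos_sq b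
    rw [this, this, ← Real.cos_neg]
    ring_nf

theorem intervalIntegral_swap_of_continuous {f : ℝ → ℝ → ℝ} (hf : Continuous (uncurry f))
    {a b c d : ℝ} (hab : a ≤ b) (hcd : c ≤ d) :
    ∫ x in a..b, ∫ y in c..d, f x y = ∫ y in c..d, ∫ x in a..b, f x y := by
  simp only [intervalIntegral.integral_of_le hab, intervalIntegral.integral_of_le hcd]
  refine integral_integral_swap ?_
  rw [Measure.prod_restrict, ← Measure.volume_eq_prod]
  refine IntegrableOn.mono_set ?_ (prod_mono Ioc_subset_Icc_self Ioc_subset_Icc_self)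
  exact hf.continuousOn.integrableOn_compact (isCompact_Icc.prod isCompact_Icc)

/-- Integral means of holomorphic functions increase with the radius. -/
theorem circleAverage_norm_rpow_mono {p : ℝ} (hp : 1 ≤ p) {r R : ℝ} (hr : 0 < r) (hrR : r < R)
    {h : ℂ → ℂ} (hh : DiffContOnCl ℂ h (ball 0 R)) :
    Real.circleAverage (fun z => ‖h z‖ ^ p) 0 r ≤ Real.circleAverage (fun z => ‖h z‖ ^ p) 0 R := by
  have hp0 : 0 < p := by linarith
  have hR : 0 < R := hr.trans hrR
  have hch := continuousOn_sphere_of_diffContOnCl hR hh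
  have hnr : ∀ s : ℝ, ‖circleMap 0 r s‖ < R := fun s => by simpa [abs_of_pos hr] using hrR
  have hcu : Continuous fun t : ℝ => ‖h (circleMap 0 R t)‖ ^ p := by
    refine Continuous.rpow_const ?_ fun _ => Or.inr hp0.le
    exact (hch.comp_continuous (continuous_circleMap 0 R)
      fun t => circleMap_mem_sphere 0 hR.le t).norm
  have hcK : Continuous fun q : ℝ × ℝ =>
      poissonKernel 0 (circleMap 0 r q.1) (circleMap 0 R q.2) := by
    simp only [poissonKernel_def, sub_zero]
    refine Continuous.div (by fun_prop) (by fun_prop) ?_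
    rintro ⟨s, t⟩
    have : circleMap 0 R t - circleMap 0 r s ≠ 0 := by
      intro h0
      have h1 := hnr s
      rw [← sub_eq_zero.mp h0] at h1
      simp [abs_of_pos hR] at h1
    positivity
  have step1 : Real.circleAverage (fun z => ‖h z‖ ^ p) 0 r ≤
      Real.circleAverage (fun w => Real.circleAverage
        (fun z => poissonKernel 0 w z * ‖h z‖ ^ p) 0 R) 0 r := by
    refine Real.circleAverage_mono ?_ ?_ ?_
    · refine ContinuousOn.circleIntegrable hr.le ?_
      refine ContinuousOn.rpow_const ?_ fun _ _ => Or.inr hp0.le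
      refine (hh.continuousOn.mono ?_).norm
      intro z hz
      refine subset_closure ?_
      simp only [mem_sphere_iff_norm, sub_zero, mem_ball_zero_iff] at hz ⊢
      linarith
    · have hcont : Continuous fun s : ℝ => (2 * π)⁻¹ • ∫ t in (0 : ℝ)..2 * π,
          poissonKernel 0 (circleMap 0 r s) (circleMap 0 R t) * ‖h (circleMap 0 R t)‖ ^ p :=
        (intervalIntegral.continuous_parametric_intervalIntegral_of_continuous'
          (f := fun s t => poissonKernel 0 (circleMap 0 r s) (circleMap 0 R t) *
            ‖h (circleMap 0 R t)‖ ^ p) (μ := volume)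
          (hcK.mul (hcu.comp continuous_snd)) 0 (2 * π)).const_smul (2 * π)⁻¹
      exact hcont.intervalIntegrable _ _
    · intro w hw
      refine norm_rpow_le_circleAverage_poissonKernel hp hh ?_
      simp only [abs_of_pos hr, mem_sphere_iff_norm, sub_zero] at hw
      linarith
  refine step1.trans (le_of_eq ?_)
  simp only [Real.circleAverage, intervalIntegral.integral_smul]
  congr 1
  -- After Fubini, the inner integral over the small circle becomes, by the swap symmetry, the total
  -- mass of a Poisson kernel on the large one.
  rw [intervalIntegral_swap_of_continuous ?_ Real.two_pi_pos.le Real.two_pi_pos.le]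
  · rw [← intervalIntegral.integral_smul]
    refine intervalIntegral.integral_congr fun t _ => ?_
    rw [intervalIntegral.integral_mul_const]
    have h1 := circleAverage_poissonKernel (hnr t)
    rw [Real.circleAverage] at h1
    simp_rw [poissonKernel_circleMap_swap (t := t)]
    rw [smul_eq_mul] at h1 ⊢
    rw [← mul_assoc, h1, one_mul]
  · exact hcK.mul (hcu.comp continuous_snd)

/-- Point evaluations are bounded by integral means. -/
theorem norm_rpow_le_mul_circleAverage {p : ℝ} (hp : 1 ≤ p) {R : ℝ} {h : ℂ → ℂ}
    (hh : DiffContOnCl ℂ h (ball 0 R)) {w : ℂ} (hw : ‖w‖ < R) :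
    ‖h w‖ ^ p ≤ (R + ‖w‖) / (R - ‖w‖) * Real.circleAverage (fun z => ‖h z‖ ^ p) 0 R := by
  have hp0 : 0 < p := by linarith
  have hR : 0 < R := (norm_nonneg w).trans_lt hw
  have hch := continuousOn_sphere_of_diffContOnCl hR hh
  have hu : ContinuousOn (fun z => ‖h z‖ ^ p) (sphere 0 R) :=
    hch.norm.rpow_const fun _ _ => Or.inr hp0.le
  refine (norm_rpow_le_circleAverage_poissonKernel hp hh hw).trans ?_
  rw [← smul_eq_mul, ← Real.circleAverage_fun_smul]
  refine Real.circleAverage_mono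
    ((continuousOn_poissonKernel_sphere hw).mul hu |>.circleIntegrable hR.le)
    ((hu.const_smul ((R + ‖w‖) / (R - ‖w‖))).circleIntegrable hR.le) ?_
  intro z hz
  rw [abs_of_pos hR] at hz
  have := re_herglotzRieszKernel_le hz (by simpa using hw : w ∈ ball 0 R)
  simp only [smul_eq_mul]
  gcongr
  rw [poissonKernel_eq_re_herglotzRieszKernel]
  simpa [herglotzRieszKernel_def] using this

/-! ### Geometry of disc automorphisms -/

namespace DiscAut

variable (φ : DiscAut)

theorem one_sub_conj_mul_re_pos {z : ℂ} (hz : ‖z‖ ≤ 1) : 0 < (1 - conj φ.a * z).re := by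
  have h1 : (conj φ.a * z).re ≤ ‖conj φ.a * z‖ := Complex.re_le_norm _
  rw [norm_mul, RCLike.norm_conj] at h1
  have := φ.norm_a
  simp only [Complex.sub_re, Complex.one_re]
  nlinarith [norm_nonneg φ.a, norm_nonneg z]

theorem one_sub_conj_mul_ne_zero {z : ℂ} (hz : ‖z‖ ≤ 1) : 1 - conj φ.a * z ≠ 0 := by
  intro h
  have := φ.one_sub_conj_mul_re_pos hz
  simp [h] at this

theorem one_sub_norm_a_sq_pos : 0 < 1 - ‖φ.a‖ ^ 2 := by
  have := φ.norm_a
  nlinarith [norm_nonneg φ.a]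

theorem conj_lam_mul_lam : conj φ.lam * φ.lam = 1 := by
  rw [mul_comm, Complex.mul_conj, Complex.normSq_eq_norm_sq, φ.norm_lam]
  simp

theorem lam_ne_zero : φ.lam ≠ 0 := by
  intro h
  have := φ.norm_lam
  simp [h] at this

theorem hasDerivAt_formula {z : ℂ} (hz : ‖z‖ ≤ 1) :
    HasDerivAt φ.formula (φ.lam * (1 - ‖φ.a‖ ^ 2 : ℝ) / (1 - conj φ.a * z) ^ 2) z := by
  have hne := φ.one_sub_conj_mul_ne_zero hz
  have h1 : HasDerivAt (fun z => φ.lam * (z - φ.a)) (φ.lam * 1) z :=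
    ((hasDerivAt_id' z).sub_const φ.a).const_mul φ.lam
  have h2 : HasDerivAt (fun z => 1 - conj φ.a * z) (-(conj φ.a * 1)) z :=
    ((hasDerivAt_id' z).const_mul (conj φ.a)).const_sub 1
  have h3 := h1.div h2 hne
  refine h3.congr_deriv ?_
  congr 1
  have : ((1 - ‖φ.a‖ ^ 2 : ℝ) : ℂ) = 1 - φ.a * conj φ.a := by
    rw [Complex.mul_conj, Complex.normSq_eq_norm_sq]
    push_cast
    ring
  rw [this]
  ring

theorem deriv_formula {z : ℂ} (hz : ‖z‖ ≤ 1) :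
    deriv φ.formula z = φ.lam * (1 - ‖φ.a‖ ^ 2 : ℝ) / (1 - conj φ.a * z) ^ 2 :=
  (φ.hasDerivAt_formula hz).deriv

theorem norm_deriv_formula {z : ℂ} (hz : ‖z‖ ≤ 1) :
    ‖deriv φ.formula z‖ = (1 - ‖φ.a‖ ^ 2) / ‖1 - conj φ.a * z‖ ^ 2 := by
  rw [φ.deriv_formula hz, norm_div, norm_mul, φ.norm_lam, one_mul, Complex.norm_real,
    Real.norm_of_nonneg φ.one_sub_norm_a_sq_pos.le, norm_pow]

theorem norm_deriv_formula_pos {z : ℂ} (hz : ‖z‖ ≤ 1) : 0 < ‖deriv φ.formula z‖ := by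
  rw [φ.norm_deriv_formula hz]
  have := φ.one_sub_norm_a_sq_pos
  have := norm_pos_iff.mpr (φ.one_sub_conj_mul_ne_zero hz)
  positivity

theorem conj_lam_mul_deriv_formula {z : ℂ} (hz : ‖z‖ ≤ 1) :
    conj φ.lam * deriv φ.formula z = (1 - ‖φ.a‖ ^ 2 : ℝ) / (1 - conj φ.a * z) ^ 2 := by
  rw [φ.deriv_formula hz, mul_div_assoc, ← mul_assoc, φ.conj_lam_mul_lam, one_mul]

/-- The value is a positive multiple of `y²` with `Re y > 0`, hence off the branch cut. This makes
the principal power holomorphic, up to and across the unit circle. -/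
theorem conj_lam_mul_deriv_formula_mem_slitPlane {z : ℂ} (hz : ‖z‖ ≤ 1) :
    conj φ.lam * deriv φ.formula z ∈ Complex.slitPlane := by
  rw [φ.conj_lam_mul_deriv_formula hz]
  have hpos := φ.one_sub_norm_a_sq_pos
  have hre : 0 < ((1 - conj φ.a * z)⁻¹).re := by
    rw [Complex.inv_re]
    exact div_pos (φ.one_sub_conj_mul_re_pos hz)
      (Complex.normSq_pos.mpr (φ.one_sub_conj_mul_ne_zero hz))
  set y := (1 - conj φ.a * z)⁻¹ with hy
  have h1 : ((1 - ‖φ.a‖ ^ 2 : ℝ) : ℂ) / (1 - conj φ.a * z) ^ 2 = (1 - ‖φ.a‖ ^ 2 : ℝ) * y ^ 2 := by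
    rw [hy, inv_pow]
    rfl
  rw [h1, Complex.mem_slitPlane_iff, Complex.re_ofReal_mul, Complex.im_ofReal_mul, sq y]
  by_cases him : y.im = 0
  · left
    rw [Complex.mul_re, him]
    have := mul_pos hre hre
    simp only [mul_zero, sub_zero]
    positivity
  · right
    rw [Complex.mul_im]
    have : y.re * y.im ≠ 0 := mul_ne_zero hre.ne' him
    refine mul_ne_zero hpos.ne' ?_
    rw [mul_comm y.im, ← two_mul]
    exact mul_ne_zero two_ne_zero this

theorem differentiableAt_formula {z : ℂ} (hz : ‖z‖ ≤ 1) : DifferentiableAt ℂ φ.formula z :=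
  (φ.hasDerivAt_formula hz).differentiableAt

theorem differentiableAt_deriv_formula {z : ℂ} (hz : ‖z‖ ≤ 1) :
    DifferentiableAt ℂ (deriv φ.formula) z := by
  have hd : ∀ᶠ w in 𝓝 z, DifferentiableAt ℂ φ.formula w := by
    have hne : ∀ᶠ w in 𝓝 z, 1 - conj φ.a * w ≠ 0 :=
      ContinuousAt.eventually_ne (by fun_prop) (φ.one_sub_conj_mul_ne_zero hz)
    filter_upwards [hne] with w hw
    unfold formula
    fun_prop (disch := exact hw)
  exact (Complex.analyticAt_iff_eventually_differentiableAt.mpr hd).deriv.differentiableAt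

/-- The weight `(conj lam * φ')^(1/p)`. -/
def weight (p : ℝ) (z : ℂ) : ℂ := (conj φ.lam * deriv φ.formula z) ^ ((1 / p : ℝ) : ℂ)

theorem differentiableAt_weight (p : ℝ) {z : ℂ} (hz : ‖z‖ ≤ 1) :
    DifferentiableAt ℂ (φ.weight p) z :=
  ((φ.differentiableAt_deriv_formula hz).const_mul _).cpow_const
    (φ.conj_lam_mul_deriv_formula_mem_slitPlane hz)

theorem norm_weight (p : ℝ) (z : ℂ) : ‖φ.weight p z‖ = ‖deriv φ.formula z‖ ^ (1 / p) := by
  rw [weight, Complex.norm_cpow_real, norm_mul, RCLike.norm_conj, φ.norm_lam, one_mul]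

theorem norm_weight_rpow {p : ℝ} (hp : p ≠ 0) (z : ℂ) :
    ‖φ.weight p z‖ ^ p = ‖deriv φ.formula z‖ := by
  rw [norm_weight, one_div, Real.rpow_inv_rpow (norm_nonneg _) hp]

theorem weight_ne_zero (p : ℝ) {z : ℂ} (hz : ‖z‖ ≤ 1) : φ.weight p z ≠ 0 := by
  rw [← norm_pos_iff, norm_weight]
  exact Real.rpow_pos_of_pos (φ.norm_deriv_formula_pos hz) _

/-- The Schwarz–Pick identity for a disc automorphism. -/
theorem one_sub_norm_formula_sq {z : ℂ} (hz : ‖z‖ ≤ 1) :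
    1 - ‖φ.formula z‖ ^ 2 = ‖deriv φ.formula z‖ * (1 - ‖z‖ ^ 2) := by
  have hne := φ.one_sub_conj_mul_ne_zero hz
  have hpos := norm_pos_iff.mpr hne
  rw [φ.norm_deriv_formula hz, formula, norm_div, norm_mul, φ.norm_lam, one_mul]
  have key : ‖1 - conj φ.a * z‖ ^ 2 - ‖z - φ.a‖ ^ 2 = (1 - ‖φ.a‖ ^ 2) * (1 - ‖z‖ ^ 2) := by
    simp only [← Complex.normSq_eq_norm_sq, Complex.normSq_apply, Complex.sub_re, Complex.sub_im,
      Complex.mul_re, Complex.mul_im, Complex.conj_re, Complex.conj_im, Complex.one_re,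
      Complex.one_im]
    ring
  rw [div_pow, div_mul_eq_mul_div, eq_div_iff (by positivity), sub_mul, one_mul,
    div_mul_cancel₀ _ (by positivity), key]

theorem norm_formula_le_one {z : ℂ} (hz : ‖z‖ ≤ 1) : ‖φ.formula z‖ ≤ 1 := by
  have h := φ.one_sub_norm_formula_sq hz
  have h2 : 0 ≤ ‖deriv φ.formula z‖ * (1 - ‖z‖ ^ 2) :=
    mul_nonneg (norm_nonneg _) (by nlinarith [norm_nonneg z])
  exact le_of_sq_le_sq (by linarith) zero_le_one

theorem norm_formula_eq_one {z : ℂ} (hz : ‖z‖ = 1) : ‖φ.formula z‖ = 1 := by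
  have h := φ.one_sub_norm_formula_sq hz.le
  rw [hz] at h
  have h1 : ‖φ.formula z‖ ^ 2 = 1 := by linarith
  exact (pow_eq_one_iff_of_nonneg (norm_nonneg _) two_ne_zero).mp h1

theorem coe_apply (z : 𝔻) : (φ z : ℂ) = φ.formula z := rfl

/-- The inverse automorphism. -/
def inv : DiscAut where
  lam := conj φ.lam
  a := -φ.lam * φ.a
  norm_lam := by rw [RCLike.norm_conj, φ.norm_lam]
  norm_a := by rw [norm_mul, norm_neg, φ.norm_lam, one_mul]; exact φ.norm_a

theorem inv_formula_formula {z : ℂ} (hz : ‖z‖ ≤ 1) : φ.inv.formula (φ.formula z) = z := by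
  have hne := φ.one_sub_conj_mul_ne_zero hz
  have hne2 := φ.inv.one_sub_conj_mul_ne_zero (φ.norm_formula_le_one hz)
  rw [formula, div_eq_iff hne2]
  simp only [inv, formula, map_mul, map_neg]
  have hl := φ.conj_lam_mul_lam
  have hne' : 1 - z * conj φ.a ≠ 0 := by rwa [mul_comm]
  field_simp
  linear_combination (z - z ^ 2 * conj φ.a) * hl

theorem inv_inv : φ.inv.inv = φ := by
  have hl := φ.conj_lam_mul_lam
  rcases φ with ⟨l, a, h1, h2⟩
  simp only [inv, Complex.conj_conj, mk.injEq, true_and]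
  simp only at hl
  linear_combination a * hl

theorem formula_inv_formula {z : ℂ} (hz : ‖z‖ ≤ 1) : φ.formula (φ.inv.formula z) = z := by
  have := φ.inv.inv_formula_formula hz
  rwa [φ.inv_inv] at this

theorem leftInverse_inv : LeftInverse φ.inv φ := fun z =>
  Complex.UnitDisc.coe_injective (φ.inv_formula_formula z.norm_lt_one.le)

theorem rightInverse_inv : Function.RightInverse φ.inv φ := fun z =>
  Complex.UnitDisc.coe_injective (φ.formula_inv_formula z.norm_lt_one.le)

/-- The chain rule for `φ ∘ φ⁻¹ = id`, in modulus. Norm estimates for the inverse of `U_φ` need no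
more, so branches of the power never have to be matched. -/
theorem norm_deriv_formula_inv {z : ℂ} (hz : ‖z‖ ≤ 1) :
    ‖deriv φ.inv.formula z‖ * ‖deriv φ.formula (φ.inv.formula z)‖ = 1 := by
  have h1 := φ.inv.norm_formula_le_one hz
  rw [φ.norm_deriv_formula h1, φ.inv.norm_deriv_formula hz]
  have hne := φ.inv.one_sub_conj_mul_ne_zero hz
  have hpos := φ.one_sub_norm_a_sq_pos
  have hpos1 := norm_pos_iff.mpr hne
  have key : 1 - conj φ.a * φ.inv.formula z =
      ((1 - ‖φ.a‖ ^ 2 : ℝ) : ℂ) / (1 - conj φ.inv.a * z) := by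
    have : ((1 - ‖φ.a‖ ^ 2 : ℝ) : ℂ) = 1 - φ.a * conj φ.a := by
      rw [Complex.mul_conj, Complex.normSq_eq_norm_sq]
      push_cast
      ring
    rw [this, formula, eq_div_iff hne, sub_mul, mul_assoc, div_mul_cancel₀ _ hne]
    simp only [inv, map_mul, map_neg]
    linear_combination (-conj φ.a * φ.a) * φ.conj_lam_mul_lam
  rw [key, norm_div, Complex.norm_real, Real.norm_of_nonneg hpos.le]
  have : ‖φ.inv.a‖ = ‖φ.a‖ := by simp [inv, φ.norm_lam]
  rw [this]
  field_simp

/-- A disc automorphism preserves the pseudo-hyperbolic distance. -/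
theorem norm_formula_sub_div {z w : ℂ} (hz : ‖z‖ < 1) (hw : ‖w‖ < 1) :
    ‖φ.formula z - φ.formula w‖ / ‖1 - conj (φ.formula w) * φ.formula z‖ =
      ‖z - w‖ / ‖1 - conj w * z‖ := by
  have hz1 := φ.one_sub_conj_mul_ne_zero hz.le
  have hw1 := φ.one_sub_conj_mul_ne_zero hw.le
  have hw2 : 1 - φ.a * conj w ≠ 0 := by
    have := (map_ne_zero (starRingEnd ℂ)).mpr hw1
    simpa using this
  have hl := φ.conj_lam_mul_lam
  have h1 : φ.formula z - φ.formula w = φ.lam * (1 - conj φ.a * φ.a) * (z - w) /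
      ((1 - conj φ.a * z) * (1 - conj φ.a * w)) := by
    have hz1' : 1 - z * conj φ.a ≠ 0 := by rwa [mul_comm]
    have hw1' : 1 - w * conj φ.a ≠ 0 := by rwa [mul_comm]
    unfold formula
    field_simp
    ring
  have h2 : 1 - conj (φ.formula w) * φ.formula z = (1 - conj φ.a * φ.a) * (1 - conj w * z) /
      ((1 - conj φ.a * z) * (1 - φ.a * conj w)) := by
    simp only [formula, map_div₀, map_mul, map_sub, map_one, Complex.conj_conj]
    have hz1' : 1 - z * conj φ.a ≠ 0 := by rwa [mul_comm]
    have hw2' : 1 - conj w * φ.a ≠ 0 := by rwa [mul_comm]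
    field_simp
    linear_combination (-(conj w - conj φ.a) * (z - φ.a)) * hl
  have h3 : ‖1 - φ.a * conj w‖ = ‖1 - conj φ.a * w‖ := by
    rw [← RCLike.norm_conj]
    simp
  have h4 : (1 - conj φ.a * φ.a) ≠ 0 := φ.one_sub_conj_mul_ne_zero φ.norm_a.le
  have h5 := norm_pos_iff.mpr h4
  have h6 := norm_pos_iff.mpr hz1
  have h7 := norm_pos_iff.mpr hw1
  rw [h1, h2]
  simp only [norm_div, norm_mul, h3, φ.norm_lam, one_mul]
  field_simp

/-- Change of variables under a disc automorphism on the unit circle. -/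
theorem circleAverage_comp_formula {u : ℂ → ℝ} (hu : ContinuousOn u (sphere 0 1)) :
    Real.circleAverage (fun z => ‖deriv φ.formula z‖ * u (φ.formula z)) 0 1 =
      Real.circleAverage u 0 1 := by
  set ρ : ℝ → ℝ := fun θ => ‖deriv φ.formula (circleMap 0 1 θ)‖ with hρ
  have hn : ∀ θ : ℝ, ‖circleMap 0 1 θ‖ = 1 := fun θ => by simp
  have hρc : Continuous ρ := by
    refine continuous_iff_continuousAt.mpr fun θ => ?_
    exact ((φ.differentiableAt_deriv_formula (hn θ).le).continuousAt.comp
      (continuous_circleMap 0 1).continuousAt).norm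
  -- `H` is an explicit lift of `φ` to the angle: below, `φ(e^{iθ}) = e^{i(H θ + α)}`, because both
  -- sides solve the same linear differential equation.
  set H : ℝ → ℝ := fun θ => ∫ t in (0 : ℝ)..θ, ρ t with hH
  have hHd : ∀ θ, HasDerivAt H (ρ θ) θ := fun θ => hρc.integral_hasStrictDerivAt 0 θ |>.hasDerivAt
  have hEd : ∀ θ : ℝ, HasDerivAt (fun θ : ℝ => φ.formula (circleMap 0 1 θ))
      (φ.formula (circleMap 0 1 θ) * (ρ θ * Complex.I)) θ := by
    intro θ
    have h1 := (φ.hasDerivAt_formula (hn θ).le).comp θ (hasDerivAt_circleMap 0 1 θ)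
    refine h1.congr_deriv ?_
    have hne := φ.one_sub_conj_mul_ne_zero (hn θ).le
    simp only [hρ]
    rw [φ.norm_deriv_formula (hn θ).le, formula]
    set c := circleMap 0 1 θ with hc
    have hcc : conj c * c = 1 := by
      rw [mul_comm, Complex.mul_conj, Complex.normSq_eq_norm_sq, hn θ]
      simp
    have hsq : ((‖1 - conj φ.a * c‖ ^ 2 : ℝ) : ℂ) = (1 - conj φ.a * c) * (1 - φ.a * conj c) := by
      rw [← Complex.normSq_eq_norm_sq, ← Complex.mul_conj]
      simp
    have hne2 : 1 - φ.a * conj c ≠ 0 := by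
      have := (map_ne_zero (starRingEnd ℂ)).mpr hne
      simpa using this
    rw [Complex.ofReal_div, hsq]
    field_simp
    linear_combination (-(φ.a * φ.lam * (1 - ‖φ.a‖ ^ 2 : ℝ))) * hcc
  have hconst : ∀ θ, φ.formula (circleMap 0 1 θ) * Complex.exp (-(H θ * Complex.I)) =
      φ.formula (circleMap 0 1 0) := by
    have hd : ∀ θ : ℝ, HasDerivAt (fun θ : ℝ => φ.formula (circleMap 0 1 θ) *
        Complex.exp (-(H θ * Complex.I))) 0 θ := by
      intro θ
      have h2 := (((hHd θ).ofReal_comp.mul_const Complex.I).neg).cexp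
      refine ((hEd θ).mul h2).congr_deriv ?_
      ring
    intro θ
    have := is_const_of_deriv_eq_zero (fun x => (hd x).differentiableAt)
      (fun x => (hd x).deriv) θ 0
    rw [this]
    simp [hH]
  obtain ⟨α, hα⟩ : ∃ α : ℝ, φ.formula (circleMap 0 1 0) = Complex.exp (α * Complex.I) :=
    ⟨_, by
      have := Complex.norm_mul_exp_arg_mul_I (φ.formula (circleMap 0 1 0))
      rw [φ.norm_formula_eq_one (hn 0), Complex.ofReal_one, one_mul] at this
      exact this.symm⟩
  have hE : ∀ θ, φ.formula (circleMap 0 1 θ) = circleMap 0 1 (H θ + α) := by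
    intro θ
    have h1 := hconst θ
    rw [hα, Complex.exp_neg, mul_inv_eq_iff_eq_mul₀ (Complex.exp_ne_zero _), ← Complex.exp_add] at h1
    rw [h1]
    simp only [circleMap, Complex.ofReal_one, zero_add, one_mul]
    push_cast
    ring_nf
  -- On the circle `|φ'|` is the Poisson kernel at `a`, whose mean is one. This replaces a winding
  -- number argument.
  have hH2 : H (2 * π) = 2 * π := by
    have h1 := circleAverage_poissonKernel (R := 1) φ.norm_a
    have h2 : ∀ θ : ℝ, poissonKernel 0 φ.a (circleMap 0 1 θ) = ρ θ := by
      intro θ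
      simp only [hρ]
      rw [φ.norm_deriv_formula (hn θ).le, poissonKernel_def]
      simp only [sub_zero, hn θ, one_pow]
      congr 2
      set c := circleMap 0 1 θ with hc
      have hcc : conj c * c = 1 := by
        rw [mul_comm, Complex.mul_conj, Complex.normSq_eq_norm_sq, hn θ]
        simp
      have : c - φ.a = c * conj (1 - conj φ.a * c) := by
        simp only [map_sub, map_one, map_mul, Complex.conj_conj]
        linear_combination φ.a * hcc
      rw [this, norm_mul, hn θ, one_mul, RCLike.norm_conj]
    rw [Real.circleAverage, smul_eq_mul] at h1
    simp only [h2] at h1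
    have h3 : (2 * π) ≠ 0 := Real.two_pi_pos.ne'
    rw [inv_mul_eq_iff_eq_mul₀ h3, mul_one] at h1
    exact h1
  have huc : Continuous fun s : ℝ => u (circleMap 0 1 s) :=
    hu.comp_continuous (continuous_circleMap 0 1) fun s => circleMap_mem_sphere 0 zero_le_one s
  rw [Real.circleAverage, Real.circleAverage]
  congr 1
  have hsub := intervalIntegral.integral_comp_mul_deriv (a := 0) (b := 2 * π)
    (f := fun θ => H θ + α) (f' := ρ) (g := fun s : ℝ => u (circleMap 0 1 s))
    (fun θ _ => (hHd θ).add_const α) hρc.continuousOn huc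
  have h0 : H 0 = 0 := by simp [hH]
  simp only [hH2, h0, comp_apply, zero_add] at hsub
  have hper : Function.Periodic (fun s : ℝ => u (circleMap 0 1 s)) (2 * π) := fun s => by
    simp only [periodic_circleMap 0 1 s]
  have hper2 := hper.intervalIntegral_add_eq α 0
  rw [zero_add] at hper2
  rw [add_comm α] at hper2
  rw [← hper2, ← hsub]
  refine intervalIntegral.integral_congr fun θ _ => ?_
  simp only [hE, hρ]
  ring

end DiscAut

/-! ### Weighted composition and multiplication on integral means -/

theorem diffContOnCl_of_forall_differentiableAt {R : ℝ} {h : ℂ → ℂ}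
    (hh : ∀ z, ‖z‖ ≤ R → DifferentiableAt ℂ h z) : DiffContOnCl ℂ h (ball 0 R) := by
  refine DifferentiableOn.diffContOnCl fun z hz => (hh z ?_).differentiableWithinAt
  simpa using closure_ball_subset_closedBall hz

theorem differentiableAt_of_norm_lt_one {F : ℂ → ℂ} (hF : DifferentiableOn ℂ F (ball 0 1)) {z : ℂ}
    (hz : ‖z‖ < 1) : DifferentiableAt ℂ F z :=
  hF.differentiableAt (isOpen_ball.mem_nhds (by simpa using hz))

theorem circleAverage_dilation (u : ℂ → ℝ) (R : ℝ) :
    Real.circleAverage (fun z => u (R * z)) 0 1 = Real.circleAverage u 0 R := by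
  simp [Real.circleAverage, circleMap]

namespace DiscAut

variable (φ : DiscAut)

/-- The dilation makes the function holomorphic across the closed disc, so its mean at radius `r` is
at most that at radius `1`, where the change of variables applies. -/
theorem circleAverage_forelli_dilation_le {p : ℝ} (hp : 1 ≤ p) {F : ℂ → ℂ}
    (hF : DifferentiableOn ℂ F (ball 0 1)) {r R : ℝ} (hr : r ∈ Ioo (0 : ℝ) 1)
    (hR : R ∈ Ioo (0 : ℝ) 1) :
    Real.circleAverage (fun z => ‖deriv φ.formula z‖ * ‖F (R * φ.formula z)‖ ^ p) 0 r ≤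
      Real.circleAverage (fun z => ‖F z‖ ^ p) 0 R := by
  have hp0 : 0 < p := by linarith
  have hRn : ∀ z : ℂ, ‖z‖ ≤ 1 → ‖(R : ℂ) * z‖ < 1 := fun z hz => by
    rw [norm_mul, Complex.norm_real, Real.norm_of_nonneg hR.1.le]
    nlinarith [hR.1, hR.2, norm_nonneg z]
  have hd : ∀ z : ℂ, ‖z‖ ≤ 1 →
      DifferentiableAt ℂ (fun z => φ.weight p z * F (R * φ.formula z)) z := fun z hz =>
    (φ.differentiableAt_weight p hz).mul
      (DifferentiableAt.comp z
        (differentiableAt_of_norm_lt_one hF (hRn _ (φ.norm_formula_le_one hz)))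
        ((φ.differentiableAt_formula hz).const_mul _))
  have h1 := circleAverage_norm_rpow_mono hp hr.1 hr.2 (diffContOnCl_of_forall_differentiableAt hd)
  simp only [norm_mul, Real.mul_rpow (norm_nonneg _) (norm_nonneg _),
    φ.norm_weight_rpow hp0.ne'] at h1
  refine h1.trans (le_of_eq ?_)
  have hu : ContinuousOn (fun z => ‖F (R * z)‖ ^ p) (sphere 0 1) := by
    refine ContinuousOn.rpow_const (ContinuousOn.norm ?_) fun _ _ => Or.inr hp0.le
    refine hF.continuousOn.comp (by fun_prop) fun z hz => ?_
    have hz : ‖z‖ = 1 := by simpa using hz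
    simpa using hRn z hz.le
  rw [φ.circleAverage_comp_formula hu]
  exact circleAverage_dilation (fun z => ‖F z‖ ^ p) R

/-- Weighted composition with a disc automorphism does not increase the Hardy norm. -/
theorem circleAverage_forelli_le {p : ℝ} (hp : 1 ≤ p) {F : ℂ → ℂ}
    (hF : DifferentiableOn ℂ F (ball 0 1)) {C : ℝ}
    (hC : ∀ r ∈ Ioo (0 : ℝ) 1, Real.circleAverage (fun z => ‖F z‖ ^ p) 0 r ≤ C) {r : ℝ}
    (hr : r ∈ Ioo (0 : ℝ) 1) :
    Real.circleAverage (fun z => ‖deriv φ.formula z‖ * ‖F (φ.formula z)‖ ^ p) 0 r ≤ C := by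
  have hp0 : 0 < p := by linarith
  have hn : ∀ θ : ℝ, ‖circleMap 0 r θ‖ < 1 := fun θ => by simpa [abs_of_pos hr.1] using hr.2
  -- Clipping makes the integrand continuous for every real `R`, so the limit `R → 1` from below is
  -- continuity of a parametric integral. On `(0, 1)` it changes nothing.
  set clip : ℝ → ℝ := fun R => max 0 (min R 1) with hclip
  have hclip01 : ∀ R, clip R ∈ Icc (0 : ℝ) 1 := fun R =>
    ⟨le_max_left _ _, max_le zero_le_one (min_le_right _ _)⟩
  have hcρ : Continuous fun θ : ℝ => ‖deriv φ.formula (circleMap 0 r θ)‖ := by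
    refine continuous_iff_continuousAt.mpr fun θ => ?_
    exact ((φ.differentiableAt_deriv_formula (hn θ).le).continuousAt.comp
      (continuous_circleMap 0 r).continuousAt).norm
  have hcφ : Continuous fun θ : ℝ => φ.formula (circleMap 0 r θ) := by
    refine continuous_iff_continuousAt.mpr fun θ => ?_
    exact (φ.differentiableAt_formula (hn θ).le).continuousAt.comp
      (continuous_circleMap 0 r).continuousAt
  have hcF : Continuous fun q : ℝ × ℝ => F (clip q.1 * φ.formula (circleMap 0 r q.2)) := by
    refine hF.continuousOn.comp_continuous ?_ fun q => ?_
    · have : Continuous clip := by fun_prop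
      exact (Complex.continuous_ofReal.comp (this.comp continuous_fst)).mul
        (hcφ.comp continuous_snd)
    · have h1 := φ.norm_formula_lt_one (hn q.2)
      have h2 := hclip01 q.1
      rw [mem_ball_zero_iff, norm_mul, Complex.norm_real, Real.norm_of_nonneg h2.1]
      nlinarith [h2.1, h2.2, norm_nonneg (φ.formula (circleMap 0 r q.2))]
  have hcont : Continuous fun R : ℝ => (2 * π)⁻¹ • ∫ θ in (0 : ℝ)..2 * π,
      ‖deriv φ.formula (circleMap 0 r θ)‖ * ‖F (clip R * φ.formula (circleMap 0 r θ))‖ ^ p :=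
    (intervalIntegral.continuous_parametric_intervalIntegral_of_continuous' (μ := volume)
      (f := fun R θ => ‖deriv φ.formula (circleMap 0 r θ)‖ *
        ‖F (clip R * φ.formula (circleMap 0 r θ))‖ ^ p)
      ((hcρ.comp continuous_snd).mul (hcF.norm.rpow_const fun _ => Or.inr hp0.le))
      0 (2 * π)).const_smul (2 * π)⁻¹
  have hlim := (hcont.tendsto 1).mono_left (nhdsWithin_le_nhds (s := Iio 1))
  have hc1 : clip 1 = 1 := by simp [hclip]
  simp only [hc1, Complex.ofReal_one, one_mul] at hlim
  rw [Real.circleAverage]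
  refine le_of_tendsto hlim ?_
  filter_upwards [Ioo_mem_nhdsLT (zero_lt_one (α := ℝ))] with R hR
  have hcR : clip R = R := by
    simp only [hclip]
    rw [min_eq_left hR.2.le, max_eq_right hR.1.le]
  rw [hcR]
  exact (φ.circleAverage_forelli_dilation_le hp hF hr hR).trans (hC R hR)

/-- A quantitative form of `|φ| → 1` at the boundary: Schwarz–Pick with `|φ'| ≤ (1 + |a|) / (1 -
|a|)`, and `1 - |φ| ≤ 1 - |φ|²`. -/
theorem le_norm_formula {z : ℂ} (hz : ‖z‖ < 1) :
    1 - (1 + ‖φ.a‖) / (1 - ‖φ.a‖) * (1 - ‖z‖ ^ 2) ≤ ‖φ.formula z‖ := by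
  have ha := φ.norm_a
  have hf := φ.norm_formula_lt_one hz
  have h1 := φ.one_sub_norm_formula_sq hz.le
  rw [φ.norm_deriv_formula hz.le] at h1
  have h2 : 1 - ‖φ.a‖ ≤ ‖1 - conj φ.a * z‖ := by
    have h3 := norm_sub_norm_le (1 : ℂ) (conj φ.a * z)
    rw [norm_mul, RCLike.norm_conj, norm_one] at h3
    nlinarith [norm_nonneg φ.a, norm_nonneg z]
  have h4 : (1 - ‖φ.a‖ ^ 2) / ‖1 - conj φ.a * z‖ ^ 2 ≤ (1 + ‖φ.a‖) / (1 - ‖φ.a‖) := by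
    have h5 : 0 < 1 - ‖φ.a‖ := by linarith
    calc (1 - ‖φ.a‖ ^ 2) / ‖1 - conj φ.a * z‖ ^ 2 ≤ (1 - ‖φ.a‖ ^ 2) / (1 - ‖φ.a‖) ^ 2 := by
          have := φ.one_sub_norm_a_sq_pos
          gcongr
      _ = (1 + ‖φ.a‖) / (1 - ‖φ.a‖) := by
          field_simp
          ring
  have h6 : 0 ≤ 1 - ‖z‖ ^ 2 := by nlinarith [norm_nonneg z]
  nlinarith [mul_le_mul_of_nonneg_right h4 h6, norm_nonneg (φ.formula z)]

/-- Multiplication by a disc automorphism does not decrease the Hardy norm. -/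
theorem circleAverage_le_of_mul_formula_le {p : ℝ} (hp : 1 ≤ p) {F : ℂ → ℂ}
    (hF : DifferentiableOn ℂ F (ball 0 1)) {C : ℝ}
    (hC : ∀ r ∈ Ioo (0 : ℝ) 1,
      Real.circleAverage (fun z => ‖φ.formula z * F z‖ ^ p) 0 r ≤ C) {r : ℝ}
    (hr : r ∈ Ioo (0 : ℝ) 1) :
    Real.circleAverage (fun z => ‖F z‖ ^ p) 0 r ≤ C := by
  have hp0 : 0 < p := by linarith
  -- `m s` bounds `|φ|` below on the circle of radius `s`. It may be negative for small `s`, but the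
  -- comparison is made at radii `s > r` tending to `1`, where `m s → 1`.
  set m : ℝ → ℝ := fun s => 1 - (1 + ‖φ.a‖) / (1 - ‖φ.a‖) * (1 - s ^ 2) with hm
  have hmc : Continuous m := by fun_prop
  have hm1 : m 1 = 1 := by simp [hm]
  have hlim : Tendsto (fun s => m s ^ p * Real.circleAverage (fun z => ‖F z‖ ^ p) 0 r)
      (𝓝[<] 1) (𝓝 (Real.circleAverage (fun z => ‖F z‖ ^ p) 0 r)) := by
    have : Continuous fun s => m s ^ p * Real.circleAverage (fun z => ‖F z‖ ^ p) 0 r :=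
      (hmc.rpow_const fun _ => Or.inr hp0.le).mul continuous_const
    have h2 := (this.tendsto 1).mono_left (nhdsWithin_le_nhds (s := Iio 1))
    simpa [hm1] using h2
  refine le_of_tendsto hlim ?_
  have hmpos : ∀ᶠ s in 𝓝[<] (1 : ℝ), 0 < m s :=
    nhdsWithin_le_nhds ((hmc.tendsto 1).eventually (lt_mem_nhds (by rw [hm1]; exact one_pos)))
  filter_upwards [hmpos, Ioo_mem_nhdsLT hr.2] with s hs hrs
  have hs0 : 0 < s := hr.1.trans hrs.1
  have hcF : ContinuousOn F (sphere 0 s) := hF.continuousOn.mono fun z hz => by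
    simp only [mem_sphere_iff_norm, sub_zero, mem_ball_zero_iff] at hz ⊢
    linarith [hrs.2]
  have hcφ : ContinuousOn φ.formula (sphere 0 s) := fun z hz => by
    simp only [mem_sphere_iff_norm, sub_zero] at hz
    exact (φ.differentiableAt_formula (by linarith [hrs.2])).continuousAt.continuousWithinAt
  have hmono := circleAverage_norm_rpow_mono hp hr.1 hrs.1
    (diffContOnCl_of_forall_differentiableAt fun z hz =>
      differentiableAt_of_norm_lt_one hF (hz.trans_lt hrs.2))
  calc m s ^ p * Real.circleAverage (fun z => ‖F z‖ ^ p) 0 r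
      ≤ m s ^ p * Real.circleAverage (fun z => ‖F z‖ ^ p) 0 s := by gcongr
    _ = Real.circleAverage (fun z => m s ^ p • ‖F z‖ ^ p) 0 s := by
        rw [Real.circleAverage_fun_smul, smul_eq_mul]
    _ ≤ Real.circleAverage (fun z => ‖φ.formula z * F z‖ ^ p) 0 s := by
        have hcFp : ContinuousOn (fun z => ‖F z‖ ^ p) (sphere 0 s) :=
          hcF.norm.rpow_const fun _ _ => Or.inr hp0.le
        refine Real.circleAverage_mono
          ((hcFp.const_smul (m s ^ p)).circleIntegrable hs0.le)
          (((hcφ.mul hcF).norm.rpow_const fun _ _ => Or.inr hp0.le).circleIntegrable hs0.le) ?_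
        intro z hz
        have hz : ‖z‖ = s := by simpa [abs_of_pos hs0] using hz
        rw [norm_mul, Real.mul_rpow (norm_nonneg _) (norm_nonneg _), smul_eq_mul]
        have := φ.le_norm_formula (z := z) (by rw [hz]; exact hrs.2)
        rw [hz] at this
        gcongr
    _ ≤ C := hC s ⟨hs0, hrs.2⟩

end DiscAut

/-! ### The operator on the Hardy space -/

theorem discExtend_eq_of_forall {f : 𝔻 → ℂ} {F : ℂ → ℂ} (h : ∀ z : 𝔻, f z = F z) {z : ℂ}
    (hz : ‖z‖ < 1) : discExtend f z = F z := by
  have := discExtend_coe f (Complex.UnitDisc.mk z hz)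
  rw [h] at this
  simpa using this

theorem isDiscHolomorphic_of_forall {f : 𝔻 → ℂ} {F : ℂ → ℂ} (h : ∀ z : 𝔻, f z = F z)
    (hF : DifferentiableOn ℂ F (ball 0 1)) : IsDiscHolomorphic f :=
  hF.congr fun _ hz => discExtend_eq_of_forall h (by simpa using hz)

theorem circleAverage_congr_of_norm_lt_one {u v : ℂ → ℝ} (h : ∀ z, ‖z‖ < 1 → u z = v z) {r : ℝ}
    (hr : r ∈ Ioo (0 : ℝ) 1) : Real.circleAverage u 0 r = Real.circleAverage v 0 r :=
  Real.circleAverage_congr_sphere fun z hz => h z (by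
    simp only [abs_of_pos hr.1, mem_sphere_iff_norm, sub_zero] at hz
    linarith [hr.2])

theorem circleAverage_norm_rpow_nonneg (p : ℝ) (F : ℂ → ℂ) (r : ℝ) :
    0 ≤ Real.circleAverage (fun z => ‖F z‖ ^ p) 0 r :=
  Real.circleAverage_nonneg_of_nonneg fun _ _ => by positivity

theorem hardyMean_le_iff {p : ℝ} (hp : 1 ≤ p) {f : 𝔻 → ℂ} {r C : ℝ} (hC : 0 ≤ C) :
    hardyMean p f r ≤ C ↔ Real.circleAverage (fun z => ‖discExtend f z‖ ^ p) 0 r ≤ C ^ p := by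
  rw [hardyMean, one_div]
  exact Real.rpow_inv_le_iff_of_pos (circleAverage_norm_rpow_nonneg _ _ _) hC (by linarith)

theorem mem_hardySubmodule_of_forall_le {p : ℝ} [Fact (1 ≤ p)] {f : 𝔻 → ℂ}
    (hf : IsDiscHolomorphic f) {C : ℝ}
    (h : ∀ r ∈ Ioo (0 : ℝ) 1, Real.circleAverage (fun z => ‖discExtend f z‖ ^ p) 0 r ≤ C ^ p)
    (hC : 0 ≤ C) : f ∈ hardySubmodule p := by
  refine ⟨hf, C, ?_⟩
  rintro _ ⟨r, hr, rfl⟩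
  exact (hardyMean_le_iff Fact.out hC).mpr (h r hr)

theorem HardySpace.norm_le_iff {p : ℝ} [Fact (1 ≤ p)] (f : HardySpace p) {C : ℝ} (hC : 0 ≤ C) :
    ‖f‖ ≤ C ↔
      ∀ r ∈ Ioo (0 : ℝ) 1, Real.circleAverage (fun z => ‖discExtend f z‖ ^ p) 0 r ≤ C ^ p :=
  ⟨fun h _ hr => (hardyMean_le_iff Fact.out hC).mp ((f.hardyMean_le_norm hr).trans h),
    fun h => f.norm_le_of_forall fun r hr => (hardyMean_le_iff Fact.out hC).mpr (h r hr)⟩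

/-- Point evaluations on the Hardy space are locally uniformly bounded. -/
theorem HardySpace.norm_apply_le {p : ℝ} [Fact (1 ≤ p)] {R : ℝ} (hR : R ∈ Ioo (0 : ℝ) 1) {ρ : ℝ}
    (hρ : ρ < R) (f : HardySpace p) {z : 𝔻} (hz : ‖(z : ℂ)‖ ≤ ρ) :
    ‖f z‖ ≤ ((R + ρ) / (R - ρ)) ^ p⁻¹ * ‖f‖ := by
  have hp : 1 ≤ p := Fact.out
  have hρ0 : 0 ≤ ρ := (norm_nonneg _).trans hz
  have h1 := norm_rpow_le_mul_circleAverage hp (diffContOnCl_of_forall_differentiableAt fun w hw =>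
      differentiableAt_of_norm_lt_one f.2.1 (hw.trans_lt hR.2)) (hz.trans_lt hρ)
  have h2 := (f.norm_le_iff (norm_nonneg f)).mp le_rfl R hR
  have h3 : ‖f z‖ ^ p ≤ (((R + ρ) / (R - ρ)) ^ p⁻¹ * ‖f‖) ^ p := by
    rw [Real.mul_rpow (by have := sub_pos.mpr hρ; have := hR.1; positivity) (norm_nonneg f),
      Real.rpow_inv_rpow (by have := sub_pos.mpr hρ; have := hR.1; positivity) (by linarith)]
    rw [← discExtend_coe (f : 𝔻 → ℂ) z]
    refine h1.trans ?_
    have := hR.1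
    have := sub_pos.mpr hρ
    gcongr
    · exact circleAverage_norm_rpow_nonneg _ _ _
    · exact h2
  exact (Real.rpow_le_rpow_iff (norm_nonneg _)
    (by have := sub_pos.mpr hρ; have := hR.1; positivity) (by linarith)).mp h3

theorem forelliOp_apply (p : ℝ) (φ : DiscAut) (f : 𝔻 → ℂ) (z : 𝔻) :
    forelliOp p φ f z = φ.weight p z * f (φ z) := rfl

theorem mulOp_apply (F f : 𝔻 → ℂ) (z : 𝔻) : mulOp F f z = F z * f z := rfl

theorem discExtend_forelliOp (p : ℝ) (φ : DiscAut) (f : 𝔻 → ℂ) {z : ℂ} (hz : ‖z‖ < 1) :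
    discExtend (forelliOp p φ f) z = φ.weight p z * discExtend f (φ.formula z) :=
  discExtend_eq_of_forall (F := fun z => φ.weight p z * discExtend f (φ.formula z))
    (fun z => by rw [forelliOp_apply, ← φ.coe_apply, discExtend_coe]) hz

theorem discExtend_mulOp (ψ : DiscAut) (f : 𝔻 → ℂ) {z : ℂ} (hz : ‖z‖ < 1) :
    discExtend (mulOp (fun z => (ψ z : ℂ)) f) z = ψ.formula z * discExtend f z :=
  discExtend_eq_of_forall (F := fun z => ψ.formula z * discExtend f z)
    (fun z => by rw [mulOp_apply, ψ.coe_apply, discExtend_coe]) hz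

theorem IsDiscHolomorphic.forelliOp {p : ℝ} (φ : DiscAut) {f : 𝔻 → ℂ} (hf : IsDiscHolomorphic f) :
    IsDiscHolomorphic (forelliOp p φ f) := by
  refine isDiscHolomorphic_of_forall
    (F := fun z => φ.weight p z * discExtend f (φ.formula z))
    (fun z => by rw [forelliOp_apply, ← φ.coe_apply, discExtend_coe]) fun z hz => ?_
  have hz : ‖z‖ < 1 := by simpa using hz
  exact ((φ.differentiableAt_weight p hz.le).mul (DifferentiableAt.comp z
    (differentiableAt_of_norm_lt_one hf (φ.norm_formula_lt_one hz))
    (φ.differentiableAt_formula hz.le))).differentiableWithinAt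

theorem IsDiscHolomorphic.mulOp (ψ : DiscAut) {f : 𝔻 → ℂ} (hf : IsDiscHolomorphic f) :
    IsDiscHolomorphic (mulOp (fun z => (ψ z : ℂ)) f) := by
  refine isDiscHolomorphic_of_forall (F := fun z => ψ.formula z * discExtend f z)
    (fun z => by rw [mulOp_apply, ψ.coe_apply, discExtend_coe]) fun z hz => ?_
  have hz : ‖z‖ < 1 := by simpa using hz
  exact ((ψ.differentiableAt_formula hz.le).mul
    (differentiableAt_of_norm_lt_one hf hz)).differentiableWithinAt

/-- The converse applies the direct estimate for `φ⁻¹` to `U_φ f`, the derivative factors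
cancelling. An equivalence for every `C` gives both membership in `H^p` and equality of norms. -/
theorem circleAverage_forelliOp_le_iff {p : ℝ} (hp : 1 ≤ p) (φ : DiscAut) {f : 𝔻 → ℂ}
    (hf : IsDiscHolomorphic f) (C : ℝ) :
    (∀ r ∈ Ioo (0 : ℝ) 1,
      Real.circleAverage (fun z => ‖discExtend (forelliOp p φ f) z‖ ^ p) 0 r ≤ C) ↔
    ∀ r ∈ Ioo (0 : ℝ) 1, Real.circleAverage (fun z => ‖discExtend f z‖ ^ p) 0 r ≤ C := by
  have hp0 : p ≠ 0 := by linarith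
  have key : ∀ z, ‖z‖ < 1 → ‖discExtend (forelliOp p φ f) z‖ ^ p =
      ‖deriv φ.formula z‖ * ‖discExtend f (φ.formula z)‖ ^ p := fun z hz => by
    rw [discExtend_forelliOp p φ f hz, norm_mul, Real.mul_rpow (norm_nonneg _) (norm_nonneg _),
      φ.norm_weight_rpow hp0]
  constructor
  · intro h r hr
    refine le_trans (le_of_eq ?_) (φ.inv.circleAverage_forelli_le hp (hf.forelliOp φ) h hr)
    refine circleAverage_congr_of_norm_lt_one (fun z hz => ?_) hr
    rw [key _ (φ.inv.norm_formula_lt_one hz), φ.formula_inv_formula hz.le, ← mul_assoc,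
      φ.norm_deriv_formula_inv hz.le, one_mul]
  · intro h r hr
    rw [circleAverage_congr_of_norm_lt_one key hr]
    exact φ.circleAverage_forelli_le hp hf h hr

theorem circleAverage_mulOp_le_iff {p : ℝ} (hp : 1 ≤ p) (ψ : DiscAut) {f : 𝔻 → ℂ}
    (hf : IsDiscHolomorphic f) (C : ℝ) :
    (∀ r ∈ Ioo (0 : ℝ) 1, Real.circleAverage
      (fun z => ‖discExtend (mulOp (fun z => (ψ z : ℂ)) f) z‖ ^ p) 0 r ≤ C) ↔
    ∀ r ∈ Ioo (0 : ℝ) 1, Real.circleAverage (fun z => ‖discExtend f z‖ ^ p) 0 r ≤ C := by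
  have hp0 : 0 < p := by linarith
  constructor
  · intro h r hr
    refine ψ.circleAverage_le_of_mul_formula_le hp hf (fun s hs => ?_) hr
    refine le_trans (le_of_eq ?_) (h s hs)
    refine circleAverage_congr_of_norm_lt_one (fun z hz => ?_) hs
    rw [discExtend_mulOp ψ f hz]
  · intro h r hr
    have hint : ∀ {g : 𝔻 → ℂ}, IsDiscHolomorphic g →
        CircleIntegrable (fun z => ‖discExtend g z‖ ^ p) 0 r := fun hg =>
      ((hg.continuous_circle hr).norm.rpow_const fun _ => Or.inr hp0.le).intervalIntegrable _ _
    refine (Real.circleAverage_mono (hint (hf.mulOp ψ)) (hint hf) fun z hz => ?_).trans (h r hr)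
    have hz : ‖z‖ < 1 := by
      simp only [abs_of_pos hr.1, mem_sphere_iff_norm, sub_zero] at hz
      linarith [hr.2]
    rw [discExtend_mulOp ψ f hz, norm_mul]
    gcongr
    exact mul_le_of_le_one_left (norm_nonneg _) (ψ.norm_formula_lt_one hz).le

/-- The weighted composition operator `M_ψ U_φ` on functions on the disc. -/
def mulForelli (p : ℝ) (φ ψ : DiscAut) : (𝔻 → ℂ) →ₗ[ℂ] (𝔻 → ℂ) :=
  mulOp (fun z => (ψ z : ℂ)) ∘ₗ forelliOp p φ

theorem mulForelli_apply (p : ℝ) (φ ψ : DiscAut) (f : 𝔻 → ℂ) (z : 𝔻) :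
    mulForelli p φ ψ f z = ψ z * (φ.weight p z * f (φ z)) := rfl

theorem IsDiscHolomorphic.mulForelli {p : ℝ} (φ ψ : DiscAut) {f : 𝔻 → ℂ}
    (hf : IsDiscHolomorphic f) : IsDiscHolomorphic (mulForelli p φ ψ f) :=
  (hf.forelliOp φ).mulOp ψ

theorem circleAverage_mulForelli_le_iff {p : ℝ} (hp : 1 ≤ p) (φ ψ : DiscAut) {f : 𝔻 → ℂ}
    (hf : IsDiscHolomorphic f) (C : ℝ) :
    (∀ r ∈ Ioo (0 : ℝ) 1, Real.circleAverage
      (fun z => ‖discExtend (mulForelli p φ ψ f) z‖ ^ p) 0 r ≤ C) ↔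
    ∀ r ∈ Ioo (0 : ℝ) 1, Real.circleAverage (fun z => ‖discExtend f z‖ ^ p) 0 r ≤ C :=
  (circleAverage_mulOp_le_iff hp ψ (hf.forelliOp φ) C).trans
    (circleAverage_forelliOp_le_iff hp φ hf C)

theorem mulForelli_mem_iff {p : ℝ} [Fact (1 ≤ p)] (φ ψ : DiscAut) {f : 𝔻 → ℂ}
    (hf : IsDiscHolomorphic f) : mulForelli p φ ψ f ∈ hardySubmodule p ↔ f ∈ hardySubmodule p := by
  constructor
  · intro h
    set g : HardySpace p := ⟨_, h⟩
    exact mem_hardySubmodule_of_forall_le hf ((circleAverage_mulForelli_le_iff Fact.out φ ψ hf _).mp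
      ((g.norm_le_iff (norm_nonneg g)).mp le_rfl)) (norm_nonneg g)
  · intro h
    set g : HardySpace p := ⟨_, h⟩
    exact mem_hardySubmodule_of_forall_le (hf.mulForelli φ ψ)
      ((circleAverage_mulForelli_le_iff Fact.out φ ψ hf _).mpr
        ((g.norm_le_iff (norm_nonneg g)).mp le_rfl)) (norm_nonneg g)

/-- A holomorphic function vanishing at the zero of `ψ` is in the range of `M_ψ U_φ`. -/
theorem exists_mulForelli_eq (p : ℝ) (φ ψ : DiscAut) {g : 𝔻 → ℂ} (hg : IsDiscHolomorphic g)
    (h0 : discExtend g ψ.a = 0) : ∃ f, IsDiscHolomorphic f ∧ mulForelli p φ ψ f = g := by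
  -- `Q` is `g / ψ` with the singularity at `ψ.a` removed; `conj ψ.lam` is the inverse of `ψ.lam`.
  set Q : ℂ → ℂ := fun z => conj ψ.lam * (1 - conj ψ.a * z) * dslope (discExtend g) ψ.a z with hQ
  have hb : ball (0 : ℂ) 1 ∈ 𝓝 ψ.a := isOpen_ball.mem_nhds (by simpa using ψ.norm_a)
  have hQd : DifferentiableOn ℂ Q (ball 0 1) := by
    refine DifferentiableOn.mul (by fun_prop) ?_
    exact (Complex.differentiableOn_dslope hb).mpr hg
  have hQe : ∀ z : ℂ, ‖z‖ < 1 → ψ.formula z * Q z = discExtend g z := by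
    intro z hz
    have h1 := sub_smul_dslope (discExtend g) ψ.a z
    rw [h0, sub_zero, smul_eq_mul] at h1
    have hne := ψ.one_sub_conj_mul_ne_zero hz.le
    rw [← h1]
    simp only [hQ, DiscAut.formula]
    rw [div_mul_eq_mul_div, div_eq_iff hne]
    linear_combination ((z - ψ.a) * (1 - conj ψ.a * z) * dslope (discExtend g) ψ.a z) *
      ψ.conj_lam_mul_lam
  refine ⟨fun z => Q (φ.inv.formula z) / φ.weight p (φ.inv.formula z), ?_, ?_⟩
  · refine isDiscHolomorphic_of_forall
      (F := fun z => Q (φ.inv.formula z) / φ.weight p (φ.inv.formula z)) (fun _ => rfl)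
      fun z hz => ?_
    have hz : ‖z‖ < 1 := by simpa using hz
    have hi := φ.inv.norm_formula_lt_one hz
    have hdi := φ.inv.differentiableAt_formula hz.le
    exact ((DifferentiableAt.comp z (differentiableAt_of_norm_lt_one hQd hi) hdi).div
      (DifferentiableAt.comp z (φ.differentiableAt_weight p hi.le) hdi)
      (φ.weight_ne_zero p hi.le)).differentiableWithinAt
  · funext z
    have hz := z.norm_lt_one
    rw [mulForelli_apply, φ.coe_apply, φ.inv_formula_formula hz.le,
      mul_div_cancel₀ _ (φ.weight_ne_zero p hz.le), ψ.coe_apply, hQe _ hz, discExtend_coe]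

/-- The operator `M_ψ U_φ` on the Hardy space, as a linear isometry. -/
def mulForelliHardy (p : ℝ) [Fact (1 ≤ p)] (φ ψ : DiscAut) : HardySpace p →ₗᵢ[ℂ] HardySpace p where
  toLinearMap := LinearMap.restrict (p := hardySubmodule p) (q := hardySubmodule p)
    (mulForelli p φ ψ) fun f hf => (mulForelli_mem_iff φ ψ hf.1).mpr hf
  norm_map' f := by
    -- The two norms agree because they have the same upper bounds.
    refine eq_of_forall_ge_iff fun C => ?_
    by_cases hC : 0 ≤ C
    · rw [HardySpace.norm_le_iff _ hC, HardySpace.norm_le_iff _ hC]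
      exact circleAverage_mulForelli_le_iff Fact.out φ ψ f.2.1 _
    · exact iff_of_false (fun h => hC ((norm_nonneg _).trans h))
        fun h => hC ((norm_nonneg _).trans h)

theorem mulForelliHardy_apply {p : ℝ} [Fact (1 ≤ p)] (φ ψ : DiscAut) (f : HardySpace p) (z : 𝔻) :
    mulForelliHardy p φ ψ f z = ψ z * (φ.weight p z * f (φ z)) := rfl

/-- Point evaluation on the Hardy space. -/
def HardySpace.eval (p : ℝ) [Fact (1 ≤ p)] (b : 𝔻) : HardySpace p →ₗ[ℂ] ℂ :=
  LinearMap.proj b ∘ₗ HardySpace.toFun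

theorem HardySpace.eval_apply {p : ℝ} [Fact (1 ≤ p)] (b : 𝔻) (f : HardySpace p) :
    HardySpace.eval p b f = f b := rfl

theorem const_mem_hardySubmodule (p : ℝ) [Fact (1 ≤ p)] (c : ℂ) :
    (fun _ : 𝔻 => c) ∈ hardySubmodule p := by
  refine mem_hardySubmodule_of_forall_le (C := ‖c‖)
    (isDiscHolomorphic_of_forall (F := fun _ => c) (fun _ => rfl) (differentiableOn_const c)) ?_
    (norm_nonneg c)
  intro r hr
  rw [circleAverage_congr_of_norm_lt_one (v := fun _ => ‖c‖ ^ p) (fun z hz => ?_) hr,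
    Real.circleAverage_const]
  rw [discExtend_eq_of_forall (F := fun _ => c) (fun _ => rfl) hz]

theorem HardySpace.eval_surjective (p : ℝ) [Fact (1 ≤ p)] (b : 𝔻) :
    Surjective (HardySpace.eval p b) := fun c => ⟨⟨_, const_mem_hardySubmodule p c⟩, rfl⟩

/-- The zero of a disc automorphism. -/
def DiscAut.zero (ψ : DiscAut) : 𝔻 := Complex.UnitDisc.mk ψ.a ψ.norm_a

theorem DiscAut.apply_eq_zero_iff (ψ : DiscAut) (z : 𝔻) : ψ z = 0 ↔ z = ψ.zero := by
  have hne := ψ.one_sub_conj_mul_ne_zero z.norm_lt_one.le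
  rw [← Complex.UnitDisc.coe_inj, ← Complex.UnitDisc.coe_inj, ψ.coe_apply, formula,
    Complex.UnitDisc.coe_zero, div_eq_zero_iff, mul_eq_zero, sub_eq_zero]
  simp [hne, ψ.lam_ne_zero, DiscAut.zero]

/-- A holomorphic preimage exists once `g` vanishes at the zero of `ψ`; it lies in `H^p` because
`mulForelli_mem_iff` works in both directions. -/
theorem range_mulForelliHardy (p : ℝ) [Fact (1 ≤ p)] (φ ψ : DiscAut) :
    LinearMap.range (mulForelliHardy p φ ψ).toLinearMap =
      LinearMap.ker (HardySpace.eval p ψ.zero) := by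
  ext g
  rw [LinearMap.mem_ker, LinearMap.mem_range, HardySpace.eval_apply]
  constructor
  · rintro ⟨f, rfl⟩
    change mulForelliHardy p φ ψ f ψ.zero = 0
    rw [mulForelliHardy_apply, (ψ.apply_eq_zero_iff ψ.zero).mpr rfl]
    simp
  · intro h
    obtain ⟨f, hf, hfg⟩ := exists_mulForelli_eq p φ ψ g.2.1 (by
      have := discExtend_coe g ψ.zero
      rw [h] at this
      exact this)
    have hm : f ∈ hardySubmodule p := by
      rw [← mulForelli_mem_iff φ ψ hf, hfg]
      exact g.2
    exact ⟨⟨f, hm⟩, Subtype.ext hfg⟩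

theorem finrank_quotient_range_mulForelliHardy (p : ℝ) [Fact (1 ≤ p)] (φ ψ : DiscAut) :
    Module.finrank ℂ (HardySpace p ⧸ LinearMap.range (mulForelliHardy p φ ψ).toLinearMap) = 1 := by
  rw [range_mulForelliHardy, (LinearMap.quotKerEquivOfSurjective _
    (HardySpace.eval_surjective p ψ.zero)).finrank_eq, Module.finrank_self]

/-! ### Orbits of elliptic automorphisms -/

namespace DiscAut

/-- The automorphism `z ↦ (z - q) / (1 - conj q * z)`. -/
def moebius (q : 𝔻) : DiscAut where
  lam := 1
  a := q
  norm_lam := norm_one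
  norm_a := q.norm_lt_one

theorem norm_moebius (q : 𝔻) (z : ℂ) :
    ‖(moebius q).formula z‖ = ‖z - q‖ / ‖1 - conj (q : ℂ) * z‖ := by
  simp [formula, moebius]

/-- The left and right sides are the pseudo-hyperbolic distances of `φ z` and `z` to `q`, and `φ`
preserves this distance. -/
theorem norm_moebius_apply_of_fixed {φ : DiscAut} {q : 𝔻} (hq : φ q = q) (z : 𝔻) :
    ‖((moebius q) (φ z) : ℂ)‖ = ‖((moebius q) z : ℂ)‖ := by
  have h := φ.norm_formula_sub_div z.norm_lt_one q.norm_lt_one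
  rw [← φ.coe_apply q, hq] at h
  rw [coe_apply, norm_moebius, coe_apply (moebius q), norm_moebius]
  exact h

theorem norm_moebius_iterate_of_fixed {φ : DiscAut} {q : 𝔻} (hq : φ q = q) (n : ℕ) (z : 𝔻) :
    ‖((moebius q) (φ^[n] z) : ℂ)‖ = ‖((moebius q) z : ℂ)‖ := by
  induction n with
  | zero => rfl
  | succ n ih => rw [iterate_succ_apply', norm_moebius_apply_of_fixed hq, ih]

theorem inv_apply_of_fixed {φ : DiscAut} {q : 𝔻} (hq : φ q = q) : φ.inv q = q := by
  conv_lhs => rw [← hq]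
  exact φ.leftInverse_inv q

/-- Pseudo-hyperbolic circles are Euclidean circles, with closed interior in the disc. -/
theorem exists_sphere_of_norm_moebius_eq (q : 𝔻) {s : ℝ} (hs0 : 0 ≤ s) (hs1 : s < 1) :
    ∃ (c : ℂ) (R : ℝ), (0 < s → 0 < R) ∧ ‖c‖ + R < 1 ∧
      ∀ z : 𝔻, ‖(moebius q z : ℂ)‖ = s → ‖(z : ℂ) - c‖ = R := by
  set k := ‖(q : ℂ)‖ with hk
  have hk0 : 0 ≤ k := norm_nonneg _
  have hk1 : k < 1 := q.norm_lt_one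
  have hsk : s * k < 1 := by nlinarith
  have hD : 0 < 1 - s ^ 2 * k ^ 2 := by nlinarith [mul_nonneg hs0 hk0]
  have hk2 : 0 < 1 - k ^ 2 := by nlinarith
  have hs2 : 0 < 1 - s ^ 2 := by nlinarith
  -- Centre and radius come from completing the square in `|z - q|² = s² |1 - q̄ z|²`.
  refine ⟨((1 - s ^ 2) / (1 - s ^ 2 * k ^ 2) : ℝ) * q, s * (1 - k ^ 2) / (1 - s ^ 2 * k ^ 2),
    fun h => by positivity, ?_, ?_⟩
  · rw [norm_mul, Complex.norm_real, Real.norm_of_nonneg (by positivity), ← hk, div_mul_eq_mul_div,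
      ← add_div, div_lt_one hD]
    -- Denominator minus numerator is exactly `(1 - k)(1 - s)(1 - sk)`.
    nlinarith [mul_pos (mul_pos (sub_pos.mpr hk1) (sub_pos.mpr hs1)) (sub_pos.mpr hsk)]
  · intro z hz
    have hne : 1 - conj (q : ℂ) * z ≠ 0 := (moebius q).one_sub_conj_mul_ne_zero z.norm_lt_one.le
    rw [coe_apply, norm_moebius, div_eq_iff (norm_ne_zero_iff.mpr hne)] at hz
    have h1 : ‖(z : ℂ) - q‖ ^ 2 = s ^ 2 * ‖1 - conj (q : ℂ) * z‖ ^ 2 := by rw [hz, mul_pow]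
    have h2 : ‖((1 - s ^ 2 * k ^ 2 : ℝ) : ℂ) * z - (1 - s ^ 2 : ℝ) * q‖ ^ 2 =
        (s * (1 - k ^ 2)) ^ 2 := by
      have hk3 : k ^ 2 = (q : ℂ).re * (q : ℂ).re + (q : ℂ).im * (q : ℂ).im := by
        rw [hk, ← Complex.normSq_eq_norm_sq, Complex.normSq_apply]
      rw [hk3]
      simp only [← Complex.normSq_eq_norm_sq, Complex.normSq_apply, Complex.sub_re,
        Complex.sub_im, Complex.mul_re, Complex.mul_im, Complex.conj_re, Complex.conj_im,
        Complex.one_re, Complex.one_im, Complex.ofReal_re, Complex.ofReal_im] at h1 ⊢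
      linear_combination (1 - s ^ 2 * ((q : ℂ).re * (q : ℂ).re + (q : ℂ).im * (q : ℂ).im)) * h1
    have h3 : ‖((1 - s ^ 2 * k ^ 2 : ℝ) : ℂ) * z - (1 - s ^ 2 : ℝ) * q‖ = s * (1 - k ^ 2) :=
      (pow_left_inj₀ (norm_nonneg _) (by positivity) two_ne_zero).mp h2
    have hDc : ((1 - s ^ 2 * k ^ 2 : ℝ) : ℂ) ≠ 0 := Complex.ofReal_ne_zero.mpr hD.ne'
    have h4 : (z : ℂ) - ((1 - s ^ 2) / (1 - s ^ 2 * k ^ 2) : ℝ) * q =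
        (((1 - s ^ 2 * k ^ 2 : ℝ) : ℂ) * z - (1 - s ^ 2 : ℝ) * q) / (1 - s ^ 2 * k ^ 2 : ℝ) := by
      rw [Complex.ofReal_div, sub_div, mul_div_cancel_left₀ _ hDc]
      ring
    rw [h4, norm_div, h3, Complex.norm_real, Real.norm_of_nonneg hD.le]

/-- A set of constant pseudo-hyperbolic distance from a point lies in a smaller disc. -/
theorem exists_norm_le_of_norm_moebius_eq (q z : 𝔻) : ∃ ρ < 1, ∀ w : 𝔻,
    ‖(moebius q w : ℂ)‖ = ‖(moebius q z : ℂ)‖ → ‖(w : ℂ)‖ ≤ ρ := by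
  obtain ⟨c, R, -, hcR, h⟩ :=
    exists_sphere_of_norm_moebius_eq q (norm_nonneg _) (moebius q z).norm_lt_one
  refine ⟨‖c‖ + R, hcR, fun w hw => ?_⟩
  have := norm_add_le c ((w : ℂ) - c)
  rw [add_sub_cancel, h w hw] at this
  exact this

theorem exists_norm_apply_le (ψ : DiscAut) {ρ : ℝ} (hρ : ρ < 1) :
    ∃ δ, 0 ≤ δ ∧ δ < 1 ∧ ∀ w : 𝔻, ‖(w : ℂ)‖ ≤ ρ → ‖(ψ w : ℂ)‖ ≤ δ := by
  rcases lt_or_ge ρ 0 with h0 | h0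
  · exact ⟨0, le_rfl, one_pos, fun w hw => absurd (norm_nonneg (w : ℂ)) (by linarith)⟩
  · have hc : ContinuousOn (fun z => ‖ψ.formula z‖) (closedBall 0 ρ) := fun z hz => by
      have hz : ‖z‖ ≤ ρ := by simpa using hz
      exact (ψ.differentiableAt_formula (hz.trans hρ.le)).continuousAt.norm.continuousWithinAt
    obtain ⟨x, hx, hmax⟩ := (isCompact_closedBall (0 : ℂ) ρ).exists_isMaxOn
      ⟨0, by simpa using h0⟩ hc
    have hx : ‖x‖ ≤ ρ := by simpa using hx
    exact ⟨_, norm_nonneg _, ψ.norm_formula_lt_one (hx.trans_lt hρ),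
      fun w hw => hmax (by simpa using hw)⟩

end DiscAut

/-! ### Decay along orbits and the intersection of the ranges -/

theorem HardySpace.exists_norm_apply_le (p : ℝ) [Fact (1 ≤ p)] {ρ : ℝ} (hρ : ρ < 1) :
    ∃ M, ∀ (f : HardySpace p) (z : 𝔻), ‖(z : ℂ)‖ ≤ ρ → ‖f z‖ ≤ M * ‖f‖ := by
  obtain ⟨R, hR1, hR2⟩ := exists_between (max_lt hρ one_pos)
  exact ⟨_, fun f z hz => HardySpace.norm_apply_le ⟨(le_max_right _ _).trans_lt hR1, hR2⟩
    ((le_max_left _ _).trans_lt hR1) f hz⟩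

/-- By Schwarz–Pick, the factor `(1 - |z|²)^(1/p)` absorbs `|φ'|^(1/p)`, so each application of the
operator costs only a factor `|ψ|`. -/
theorem one_sub_norm_sq_rpow_mul_norm_mulForelliHardy {p : ℝ} [Fact (1 ≤ p)] (φ ψ : DiscAut)
    (f : HardySpace p) (z : 𝔻) :
    (1 - ‖(z : ℂ)‖ ^ 2) ^ (1 / p) * ‖mulForelliHardy p φ ψ f z‖ =
      ‖(ψ z : ℂ)‖ * ((1 - ‖(φ z : ℂ)‖ ^ 2) ^ (1 / p) * ‖f (φ z)‖) := by
  have hz := z.sq_norm_lt_one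
  rw [mulForelliHardy_apply, norm_mul, norm_mul, φ.norm_weight, φ.coe_apply,
    φ.one_sub_norm_formula_sq z.norm_lt_one.le, Real.mul_rpow (norm_nonneg _) (by linarith)]
  ring

theorem mulForelliHardy_eq_zero_of_mem_range_pow {p : ℝ} [Fact (1 ≤ p)] (φ ψ : DiscAut) {q : 𝔻}
    (hq : φ q = q) {f : HardySpace p}
    (hf : ∀ n : ℕ, 1 ≤ n → f ∈ range ((mulForelliHardy p φ ψ).toContinuousLinearMap ^ n)) :
    f = 0 := by
  have hp : 1 ≤ p := Fact.out
  set S := (mulForelliHardy p φ ψ).toContinuousLinearMap with hS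
  have hSn : ∀ (n : ℕ) (g : HardySpace p), ‖(S ^ n) g‖ = ‖g‖ := by
    intro n g
    induction n with
    | zero => rfl
    | succ n ih => rw [pow_succ', mul_apply_eq_comp, ← ih]; exact
        (mulForelliHardy p φ ψ).norm_map _
  refine Subtype.ext (funext fun z => ?_)
  change f z = 0
  obtain ⟨ρ, hρ, horb⟩ := DiscAut.exists_norm_le_of_norm_moebius_eq q z
  obtain ⟨M, hM⟩ := HardySpace.exists_norm_apply_le p hρ
  obtain ⟨δ, hδ0, hδ1, hδ⟩ := ψ.exists_norm_apply_le hρ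
  -- The claim covers all `w` at the same pseudo-hyperbolic distance from `q` as `z`, since the
  -- induction step passes from `w` to `φ w`.
  have hpow : ∀ (n : ℕ) (g : HardySpace p) (w : 𝔻),
      ‖(DiscAut.moebius q w : ℂ)‖ = ‖(DiscAut.moebius q z : ℂ)‖ →
      (1 - ‖(w : ℂ)‖ ^ 2) ^ (1 / p) * ‖(S ^ n) g w‖ ≤ δ ^ n * (M * ‖g‖) := by
    intro n g
    induction n with
    | zero =>
      intro w hw
      have h1 := w.sq_norm_lt_one
      rw [pow_zero S, pow_zero δ, one_mul, one_apply_eq_self]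
      refine (mul_le_of_le_one_left (norm_nonneg _) ?_).trans (hM g w (horb w hw))
      exact Real.rpow_le_one (by linarith) (by linarith [sq_nonneg ‖(w : ℂ)‖]) (by positivity)
    | succ n ih =>
      intro w hw
      have h1 := (φ w).sq_norm_lt_one
      rw [pow_succ' S, mul_apply_eq_comp]
      refine (one_sub_norm_sq_rpow_mul_norm_mulForelliHardy φ ψ ((S ^ n) g) w).le.trans ?_
      rw [pow_succ' δ, mul_assoc]
      refine mul_le_mul (hδ w (horb w hw))
        (ih (φ w) ((DiscAut.norm_moebius_apply_of_fixed hq w).trans hw)) ?_ hδ0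
      exact mul_nonneg (Real.rpow_nonneg (by linarith) _) (norm_nonneg _)
  have hle : ∀ n : ℕ, 1 ≤ n →
      (1 - ‖(z : ℂ)‖ ^ 2) ^ (1 / p) * ‖f z‖ ≤ δ ^ n * (M * ‖f‖) := by
    intro n hn
    obtain ⟨g, hg⟩ := hf n hn
    have h1 := hpow n g z rfl
    -- The preimage `g` depends on `n`, but isometry replaces its norm by `‖f‖`.
    rw [← hSn n g, hg] at h1
    exact h1
  have hlim : Tendsto (fun n : ℕ => δ ^ n * (M * ‖f‖)) atTop (𝓝 0) := by
    simpa using (tendsto_pow_atTop_nhds_zero_of_lt_one hδ0 hδ1).mul_const (M * ‖f‖)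
  have h0 := ge_of_tendsto hlim (eventually_atTop.mpr ⟨1, hle⟩)
  have hz := z.sq_norm_lt_one
  have hpos : 0 < (1 - ‖(z : ℂ)‖ ^ 2) ^ (1 / p) := Real.rpow_pos_of_pos (by linarith) _
  exact norm_le_zero_iff.mp (nonpos_of_mul_nonpos_right h0 hpos)

theorem isCrownover_mulForelliHardy (p : ℝ) [Fact (1 ≤ p)] (φ ψ : DiscAut) {q : 𝔻}
    (hq : φ q = q) : IsCrownover (mulForelliHardy p φ ψ).toContinuousLinearMap where
  isometry := (mulForelliHardy p φ ψ).isometry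
  codim_one := finrank_quotient_range_mulForelliHardy p φ ψ
  iInter_range := by
    refine eq_singleton_iff_unique_mem.mpr ⟨?_, fun f hf => ?_⟩
    · exact mem_iInter₂.mpr fun n _ => ⟨0, map_zero _⟩
    · exact mulForelliHardy_eq_zero_of_mem_range_pow φ ψ hq fun n hn => mem_iInter₂.mp hf n hn

/-! ### The zeros of `ψ ∘ φ_n` -/

theorem DiscAut.apply_iterate_eq_zero_iff (φ ψ : DiscAut) (n : ℕ) (z : 𝔻) :
    ψ (φ^[n] z) = 0 ↔ z = φ.inv^[n] ψ.zero := by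
  rw [ψ.apply_eq_zero_iff]
  constructor
  · intro h
    rw [← h, (φ.leftInverse_inv.iterate n) z]
  · rintro rfl
    exact (φ.rightInverse_inv.iterate n) ψ.zero

/-- The backward orbit of a point under an automorphism fixing `q` lies on a circle. -/
theorem DiscAut.exists_sphere_iterate {φ : DiscAut} {q : 𝔻} (hq : φ q = q) (b : 𝔻) :
    ∃ (c : ℂ) (R : ℝ), 0 < R ∧ ‖c‖ + R < 1 ∧ ∀ n : ℕ, ((φ^[n] b : 𝔻) : ℂ) ∈ sphere c R := by
  rcases (norm_nonneg (moebius q b : ℂ)).eq_or_lt with h0 | hpos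
  · have hb : b = q := by
      have h1 : moebius q b = 0 := by
        rw [← Complex.UnitDisc.coe_eq_zero]
        exact norm_eq_zero.mp h0.symm
      exact ((moebius q).apply_eq_zero_iff b).mp h1
    subst hb
    have hb1 := b.norm_lt_one
    -- The orbit is the single point `b`, so any circle through `b` inside the disc will do. With
    -- shift and radius `(1 - |b|) / 3`, `|c| + R ≤ |b| + 2(1 - |b|) / 3 < 1`.
    refine ⟨b + ((1 - ‖(b : ℂ)‖) / 3 : ℝ), (1 - ‖(b : ℂ)‖) / 3, by linarith, ?_, fun n => ?_⟩
    · have h2 := norm_add_le (b : ℂ) ((1 - ‖(b : ℂ)‖) / 3 : ℝ)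
      rw [Complex.norm_real, Real.norm_of_nonneg (by linarith)] at h2
      linarith
    · rw [iterate_fixed hq, mem_sphere_iff_norm, sub_add_cancel_left, norm_neg, Complex.norm_real,
        Real.norm_of_nonneg (by linarith)]
  · obtain ⟨c, R, hR, hcR, h⟩ :=
      exists_sphere_of_norm_moebius_eq q hpos.le (moebius q b).norm_lt_one
    refine ⟨c, R, hR hpos, hcR, fun n => ?_⟩
    rw [mem_sphere_iff_norm]
    exact h _ (norm_moebius_iterate_of_fixed hq n b)

/-- The terms are at least `1 - (‖c‖ + R) > 0`, so they do not tend to zero. -/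
theorem not_summable_one_sub_norm {a : ℕ → 𝔻} {c : ℂ} {R : ℝ} (hcR : ‖c‖ + R < 1)
    (h : ∀ n, (a n : ℂ) ∈ sphere c R) : ¬ Summable fun n => 1 - ‖(a n : ℂ)‖ := by
  intro hs
  have h1 := ge_of_tendsto' hs.tendsto_atTop_zero (b := 1 - (‖c‖ + R)) fun n => by
    have h2 := norm_add_le c ((a n : ℂ) - c)
    rw [add_sub_cancel, mem_sphere_iff_norm.mp (h n)] at h2
    linarith
  linarith

end

theorem proposition3 {p : ℝ} [Fact (1 ≤ p)] (hp2 : p ≠ 2) (φ ψ : DiscAut)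
    (hφ : φ.IsElliptic) :
    (∃ S : HardySpace p →L[ℂ] HardySpace p,
      (∀ f : HardySpace p, (S f : 𝔻 → ℂ) = mulOp (fun z => (ψ z : ℂ)) (forelliOp p φ f)) ∧
        IsCrownover S) ∧
    ∃ a : ℕ → 𝔻, (∀ (n : ℕ) (z : 𝔻), ψ (φ^[n] z) = 0 ↔ z = a n) ∧
      (∃ (c : ℂ) (R : ℝ), 0 < R ∧ closedBall c R ⊆ ball 0 1 ∧ ∀ n, (a n : ℂ) ∈ sphere c R) ∧
      ¬ Summable (fun n => 1 - ‖(a n : ℂ)‖) := by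
  obtain ⟨-, q, hq⟩ := hφ
  refine ⟨⟨_, fun f => rfl, isCrownover_mulForelliHardy p φ ψ hq⟩, fun n => φ.inv^[n] ψ.zero,
    φ.apply_iterate_eq_zero_iff ψ, ?_⟩
  -- The zeros form the orbit of `ψ.zero` under `φ.inv`, which fixes the same point `q`.
  obtain ⟨c, R, hR, hcR, h⟩ := DiscAut.exists_sphere_iterate (DiscAut.inv_apply_of_fixed hq) ψ.zero
  refine ⟨⟨c, R, hR, fun z hz => ?_, h⟩, not_summable_one_sub_norm hcR h⟩
  have h2 := norm_add_le c (z - c)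
  rw [mem_closedBall_iff_norm] at hz
  rw [add_sub_cancel] at h2
  rw [mem_ball_zero_iff]
  linarith
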